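/- Let $(Q,I)$ be a quiver with relations: $Q$ is a finite quiver with vertex set $V$, and $I\subset\mathbb{C}Q$ is a two-sided ideal spanned by linear combinations of paths of length at least $2$. Assume that $\mathbb{C}Q/I$ is finite-dimensional. Let $\mathcal{A}=\operatorname{rep}(Q,I)$ be the category of its finite-dimensional complex representations, $N=\mathbb{Z}^{V}$, $M_{\mathbb{R}}=\operatorname{Hom}_{\mathbb{Z}}(N,\mathbb{R})$, and for $\theta\in M_{\mathbb{R}}$ write $\theta(E)=\theta(d(E))$, where $d(E)\in N$ is the dimension vector. An object $E\in\mathcal{A}$ is called $\theta$-semistable if $\theta(E)=0$ and $\theta(A)\le 0$ for every subobject $A\subset E$. Put $$\mathcal{T}(\theta)=\{E\in\mathcal{A}:\theta(B)>0\text{ for every nonzero quotient }E\twoheadrightarrow B\},\qquad \mathcal{F}(\theta)=\{E\in\mathcal{A}:\theta(A)\le 0\text{ for every subobject }A\subset E\}.$$ Let $\mathcal{D}$ be a triangulated category equipped with a bounded t-structure whose heart is identified with $\mathcal{A}$, with cohomology objects $H^i(E)\in\mathcal{A}$; for $E\in\mathcal{D}$ put $d(E)=\sum_i(-1)^i d(H^i(E))\in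 N$. (For example, if $(Q,W)$ is a 2-acyclic quiver with finite potential and finite-dimensional Jacobi algebra, $\mathcal{D}$ may be the CY$_3$ bounded derived category of its Ginzburg algebra with its standard t-structure, with $\mathcal{A}=\operatorname{mod}J(Q,W)$.) Let $\mathcal{A}(\theta)\subset\mathcal{D}$ be the full subcategory of objects $E$ with $H^{-1}(E)\in\mathcal{F}(\theta)$, $H^0(E)\in\mathcal{T}(\theta)$ and $H^i(E)=0$ for $i\neq -1,0$. Let $\operatorname{Stab}(\mathcal{D})$ be the space of stability conditions $\sigma=(Z,\mathcal{P})$ on $\mathcal{D}$ whose central charge is a homomorphism $Z\colon N\to\mathbb{C}$, evaluated on objects by $Z(E)=Z(d(E))$, and which satisfy the support property: there is $K>0$ with $|Z(E)|>K\|d(E)\|$ for all nonzero semistable $E$. It carries the topology induced by Bridgeland's generalized metric on slicings and the usual topology on central charges. For an interval $J\subset\mathbb{R}$ let $\mathcal{P}(J)$ be the full subcategory of objects all of whose Harder–Narasimhan phases lie in $J$; the heart of $\sigma$ is $\mathcal{P}((0,1])$. The wall of type II defined by an object $0\ne E\in\mathcal{D}$ is the locus of all $\sigma$ with $E\in\mathcal{P}(0)$.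 Let $\mathcal{C}(\mathcal{A})\subset\operatorname{Stab}(\mathcal{D})$ be the subset of those $\sigma$ with $\mathcal{A}\subset\mathcal{P}((-1,1))$, and let $F\colon\mathcal{C}(\mathcal{A})\to M_{\mathbb{R}}$ be the map $F(Z,\mathcal{P})=\operatorname{Im}Z$. Finally let $\mathcal{W}\subset M_{\mathbb{R}}$ be the support of the scattering diagram of $(Q,I)$, that is, the union over $k\ge 1$ of the supports of its underlying cone complexes $\mathfrak{S}_k$. Here $\mathfrak{S}_k$ consists of the cones $$\{\theta\in M_{\mathbb{R}}:\theta(n)\ge 0\ (n\in P_+),\ \theta(n)=0\ (n\in P_0),\ \theta(n)\le 0\ (n\in P_-)\},$$ for partitions $P_+\sqcup P_0\sqcup P_-$ with $P_0\ne\emptyset$ of the set of nonzero $n\in N$ with non-negative coordinates and coordinate sum at most $k$, such that some nonzero $E\in\mathcal{A}$ of total dimension at most $k$ is $\theta$-semistable for all $\theta$ in the cone. Then $\mathcal{C}(\mathcal{A})$ is open in $\operatorname{Stab}(\mathcal{D})$, and the following hold. (a) The map $F\colon\mathcal{C}(\mathcal{A})\to M_{\mathbb{R}}$ is surjective. (b)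 For every $\theta\in M_{\mathbb{R}}$ the pair $(\mathcal{T}(\theta),\mathcal{F}(\theta))$ is a torsion pair in $\mathcal{A}$, and every $\sigma\in\mathcal{C}(\mathcal{A})$ with $F(\sigma)=\theta$ has heart $\mathcal{A}(\theta)$, the tilt of $\mathcal{A}$ at this torsion pair. In particular all stability conditions in a given fibre of $F$ have the same heart. (c) If $\sigma\in\mathcal{C}(\mathcal{A})$ and $F(\sigma)=\theta$, then $\mathcal{P}(0)$ is the subcategory of $\theta$-semistable objects of $\mathcal{A}$. The image under $F$ of the union of the walls of type II in $\mathcal{C}(\mathcal{A})$ is exactly $\mathcal{W}$, and $\mathcal{W}$ is the set of those $\theta\in M_{\mathbb{R}}$ for which there exists a nonzero $\theta$-semistable object of $\mathcal{A}$. -/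

import Mathlib

open CategoryTheory CategoryTheory.Limits CategoryTheory.Pretriangulated

universe v u v' u'

noncomputable section

/-! ### Quivers with relations and their representations -/

/-- A two-sided ideal `I ⊆ ℂQ` spanned by linear combinations of paths of length at least two, for
the quiver `Q` with vertex set `V`.  Since `ℂQ` is the direct sum of the spaces `e_b ℂQ e_a` of
linear combinations of paths from `a` to `b`, the ideal is recorded through its components. -/
structure QuiverRelations (V : Type u) [Quiver.{v + 1} V] where
  /-- the part of the ideal consisting of combinations of paths from `a` to `b` -/
  rel (a b : V) : Submodule ℂ (Quiver.Path a b →₀ ℂ)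
  comp_right {a b c : V} (x : Quiver.Path a b →₀ ℂ) (q : Quiver.Path b c) :
    x ∈ rel a b → Finsupp.mapDomain (fun p => p.comp q) x ∈ rel a c
  comp_left {a b c : V} (p : Quiver.Path a b) (x : Quiver.Path b c →₀ ℂ) :
    x ∈ rel b c → Finsupp.mapDomain (fun q => p.comp q) x ∈ rel a c
  two_le_length {a b : V} (x : Quiver.Path a b →₀ ℂ) (hx : x ∈ rel a b) :
    ∀ p ∈ x.support, 2 ≤ p.length

namespace QuiverRelations

variable {V : Type u} [Quiver.{v + 1} V] (R : QuiverRelations V)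

/-- The algebra `ℂQ/I` is finite-dimensional.  (The quiver being finite, this says that each of its
finitely many components `e_b (ℂQ/I) e_a` is.) -/
def IsFiniteDimensional : Prop :=
  ∀ a b : V, Module.Finite ℂ ((Quiver.Path a b →₀ ℂ) ⧸ R.rel a b)

/-- A representation of the quiver (a functor on the category of paths with values in
finite-dimensional complex vector spaces) satisfies the relations if each element of the ideal
acts by zero. -/
def Satisfies : ObjectProperty (Paths V ⥤ FGModuleCat.{0} ℂ) := fun F =>
  ∀ (a b : V) (x : Quiver.Path a b →₀ ℂ), x ∈ R.rel a b →
    (x.sum fun p c => c • (F.map (X := (Paths.of V).obj a) (Y := (Paths.of V).obj b) p).hom.hom) = 0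

/-- The category `𝒜 = rep(Q, I)` of finite-dimensional representations of the quiver with
relations. -/
abbrev Rep := R.Satisfies.FullSubcategory

end QuiverRelations

section Weights

variable {V : Type u} [Quiver.{v + 1} V] {R : QuiverRelations V}

/-- The dimension vector `d(M) ∈ N = ℤ^V` of a representation `M`. -/
def dimVec (M : R.Rep) : V → ℤ := fun i => Module.finrank ℂ (M.obj.obj ((Paths.of V).obj i))

variable (R)

/-- `M` is `θ`-semistable: `θ(M) = 0` and every subobject `L` of `M` has `θ(L) ≤ 0`.
Here `θ ∈ M_ℝ = Hom(N, ℝ)`. -/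
def IsSemistable (θ : (V → ℤ) →+ ℝ) : ObjectProperty R.Rep := fun M =>
  θ (dimVec M) = 0 ∧ ∀ (L : R.Rep) (i : L ⟶ M), Mono i → θ (dimVec L) ≤ 0

/-- The class `𝒯(θ)` of the objects all of whose nonzero quotients `L` have `θ(L) > 0`. -/
def torsionPart (θ : (V → ℤ) →+ ℝ) : ObjectProperty R.Rep := fun M =>
  ∀ (L : R.Rep) (p : M ⟶ L), Epi p → ¬ IsZero L → 0 < θ (dimVec L)

/-- The class `ℱ(θ)` of the objects all of whose subobjects `L` have `θ(L) ≤ 0`. -/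
def torsionFreePart (θ : (V → ℤ) →+ ℝ) : ObjectProperty R.Rep := fun M =>
  ∀ (L : R.Rep) (i : L ⟶ M), Mono i → θ (dimVec L) ≤ 0

end Weights

/-- `(𝒯, ℱ)` is a torsion pair in `A`. -/
def IsTorsionPair {A : Type u} [Category.{v} A] [HasZeroMorphisms A]
    (𝒯 ℱ : ObjectProperty A) : Prop :=
  (∀ (X Y : A) (f : X ⟶ Y), 𝒯 X → ℱ Y → f = 0) ∧
  ∀ E : A, ∃ S : ShortComplex A, S.ShortExact ∧ 𝒯 S.X₁ ∧ S.X₂ = E ∧ ℱ S.X₃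

/-! ### The cone complexes underlying the scattering diagram -/

section Scattering

variable {V : Type u} [Fintype V] [Quiver.{v + 1} V]

/-- The classes `n ∈ N⁺` (nonzero, with non-negative coordinates) with `δ(n) = ∑ nᵢ ≤ k`. -/
def boundedPositive (V : Type u) [Fintype V] (k : ℕ) : Set (V → ℤ) :=
  {n | n ≠ 0 ∧ (∀ i, 0 ≤ n i) ∧ ∑ i, n i ≤ k}

/-- The cone `σ(P₊, P₀, P₋)` in `M_ℝ`. -/
def signCone (Ppos Pzero Pneg : Set (V → ℤ)) : Set ((V → ℤ) →+ ℝ) :=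
  {θ | (∀ n ∈ Ppos, 0 ≤ θ n) ∧ (∀ n ∈ Pzero, θ n = 0) ∧ (∀ n ∈ Pneg, θ n ≤ 0)}

/-- The cone complex `𝔖_k` underlying the scattering diagram of `(Q, I)` in degrees `≤ k`.  It
consists of those cones `σ(P₊, P₀, P₋)`, where `P₊ ⊔ P₀ ⊔ P₋` is a partition of the set of all
`n ∈ N⁺` with `δ(n) ≤ k` and `P₀` is nonempty, that support a nonzero semistable object of total
dimension at most `k`. -/
def scatteringComplex (R : QuiverRelations V) (k : ℕ) : Set (Set ((V → ℤ) →+ ℝ)) :=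
  {c | ∃ Ppos Pzero Pneg : Set (V → ℤ),
    Ppos ∪ Pzero ∪ Pneg = boundedPositive V k ∧
    Disjoint Ppos Pzero ∧ Disjoint Ppos Pneg ∧ Disjoint Pzero Pneg ∧ Pzero.Nonempty ∧
    c = signCone Ppos Pzero Pneg ∧
    ∃ M : R.Rep, ¬ IsZero M ∧ ∑ i, dimVec M i ≤ k ∧ ∀ θ ∈ c, IsSemistable R θ M}

/-- The support of the scattering diagram of `(Q, I)`: the union of all cones of the cone complexes
`𝔖_k`, `k ≥ 1`. -/
def scatteringSupport (R : QuiverRelations V) : Set ((V → ℤ) →+ ℝ) :=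
  ⋃ k ≥ 1, ⋃ c ∈ scatteringComplex R k, c

end Scattering

/-! ### Cohomology with respect to a bounded t-structure, dimension vectors, tilting -/

section TStructure

open Triangulated

variable {D : Type u'} [Category.{v'} D] [Preadditive D] [HasZeroObject D] [HasShift D ℤ]
  [∀ n : ℤ, (shiftFunctor D n).Additive] [Pretriangulated D] [IsTriangulated D]

lemma heart_shift_truncGELE (t : TStructure D) (i : ℤ) (E : D) :
    t.heart (((t.truncGELE i i).obj E)⟦i⟧) := by
  rw [t.mem_heart_iff]
  have h1 : t.IsGE ((t.truncGELE i i).obj E) i := inferInstance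
  have h2 : t.IsLE ((t.truncGELE i i).obj E) i := by
    dsimp [TStructure.truncGELE]
    infer_instance
  exact ⟨t.isLE_shift _ i i 0, t.isGE_shift _ i i 0⟩

/-- The `i`-th cohomology object `H^i(E) = (τ^{≥ i} τ^{≤ i} E)[i]` of `E`, as an object of a
category `A` identified with the heart of the t-structure. -/
def heartCohomology (t : TStructure D) (A : Type u) [Category.{v} A] [Preadditive A] [t.Heart A]
    (i : ℤ) (E : D) : A :=
  Functor.essImage.witness (F := t.ιHeart (H := A)) (Y := ((t.truncGELE i i).obj E)⟦i⟧)
    (by rw [t.essImage_ιHeart A]; exact heart_shift_truncGELE t i E)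

variable {V : Type u} [Quiver.{v + 1} V] (R : QuiverRelations V)

/-- The dimension vector `d(E) = ∑ᵢ (-1)^i d(H^i(E)) ∈ N` of an object `E` of a triangulated category
with a (bounded) t-structure whose heart is `rep(Q, I)`. -/
def dimVecD (t : TStructure D) [t.Heart R.Rep] (E : D) : V → ℤ :=
  ∑ᶠ i : ℤ, (i.negOnePow : ℤ) • dimVec (heartCohomology t R.Rep i E)

/-- The tilted heart `𝒜(θ)`: the objects `E` such that `H^{-1}(E) ∈ ℱ(θ)`, `H^0(E) ∈ 𝒯(θ)`
and `H^i(E) = 0` for all other `i`. -/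
def tiltedHeart (t : TStructure D) [t.Heart R.Rep] (θ : (V → ℤ) →+ ℝ) : ObjectProperty D :=
  fun E => torsionFreePart R θ (heartCohomology t R.Rep (-1) E) ∧
    torsionPart R θ (heartCohomology t R.Rep 0 E) ∧
    ∀ i : ℤ, i ≠ -1 → i ≠ 0 → IsZero (heartCohomology t R.Rep i E)

end TStructure

/-! ### Stability conditions -/

section Stability

open Triangulated

variable {D : Type u'} [Category.{v'} D] [Preadditive D] [HasZeroObject D] [HasShift D ℤ]
  [∀ n : ℤ, (shiftFunctor D n).Additive] [Pretriangulated D]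

/-- `E` has a Harder–Narasimhan filtration with respect to the subcategories `P(φ)`, of length `n`
and with phases `φ 0 > φ 1 > ⋯ > φ (n - 1)`: a sequence `0 = X 0 ⟶ X 1 ⟶ ⋯ ⟶ X n = E` together
with distinguished triangles `X i ⟶ X (i + 1) ⟶ F i ⟶ (X i)[1]`, where `0 ≠ F i ∈ P(φ i)`. -/
def HasHNFiltration (P : ℝ → ObjectProperty D) (E : D) (n : ℕ) (φ : Fin n → ℝ) : Prop :=
  StrictAnti φ ∧ ∃ (X : Fin (n + 1) → D) (F : Fin n → D),
    IsZero (X 0) ∧ Nonempty (X (Fin.last n) ≅ E) ∧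
    ∀ i : Fin n, P (φ i) (F i) ∧ ¬ IsZero (F i) ∧
      ∃ (f : X i.castSucc ⟶ X i.succ) (g : X i.succ ⟶ F i) (h : F i ⟶ (X i.castSucc)⟦(1 : ℤ)⟧),
        Triangle.mk f g h ∈ distTriang D

variable [IsTriangulated D]

/-- A stability condition `σ = (Z, P)` with the support property on a triangulated category `D` with
a bounded t-structure whose heart is `rep(Q, I)`.  The central charge is a homomorphism `Z : N → ℂ`,
evaluated on objects through their dimension vectors. -/
structure StabilityCondition {V : Type u} [Fintype V] [Quiver.{v + 1} V] (R : QuiverRelations V)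
    (t : TStructure D) [t.Heart R.Rep] where
  /-- the central charge -/
  Z : (V → ℤ) →+ ℂ
  /-- the full subcategory `P(φ)` of semistable objects of phase `φ` -/
  P : ℝ → ObjectProperty D
  P_iso (φ : ℝ) {X Y : D} (e : X ≅ Y) : P φ X → P φ Y
  P_zero (φ : ℝ) (X : D) : IsZero X → P φ X
  P_biprod (φ : ℝ) (X Y : D) : P φ X → P φ Y → P φ (X ⊞ Y)
  charge (φ : ℝ) (E : D) : P φ E → ¬ IsZero E →
    ∃ m : ℝ, 0 < m ∧ Z (dimVecD R t E) = m * Complex.exp (Real.pi * φ * Complex.I)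
  P_shift (φ : ℝ) (X : D) : P (φ + 1) (X⟦(1 : ℤ)⟧) ↔ P φ X
  hom_eq_zero (φ ψ : ℝ) (X Y : D) (f : X ⟶ Y) : ψ < φ → P φ X → P ψ Y → f = 0
  exists_hn (E : D) : ¬ IsZero E → ∃ (n : ℕ) (φ : Fin n → ℝ), HasHNFiltration P E n φ
  support : ∃ K : ℝ, 0 < K ∧ ∀ (φ : ℝ) (E : D), P φ E → ¬ IsZero E →
    K * ‖dimVecD R t E‖ < ‖Z (dimVecD R t E)‖

namespace StabilityCondition

variable {V : Type u} [Fintype V] [Quiver.{v + 1} V] {R : QuiverRelations V}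
  {t : TStructure D} [t.Heart R.Rep]

/-- The full subcategory `P(I)` of the objects all of whose Harder–Narasimhan phases lie in `I`
(with the zero objects, whose filtration has length zero). -/
def PInterval (σ : StabilityCondition R t) (I : Set ℝ) : ObjectProperty D := fun E =>
  ∃ (n : ℕ) (φ : Fin n → ℝ), HasHNFiltration σ.P E n φ ∧ ∀ i, φ i ∈ I

/-- The heart `P(0, 1]` of a stability condition. -/
def heart (σ : StabilityCondition R t) : ObjectProperty D := σ.PInterval (Set.Ioc 0 1)

/-- The set of Harder–Narasimhan phases of an object. -/
def phases (σ : StabilityCondition R t) (E : D) : Set ℝ :=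
  {x | ∃ (n : ℕ) (φ : Fin n → ℝ), HasHNFiltration σ.P E n φ ∧ x ∈ Set.range φ}

/-- The largest Harder–Narasimhan phase of a nonzero object. -/
def phiPlus (σ : StabilityCondition R t) (E : D) : ℝ := sSup (σ.phases E)

/-- The smallest Harder–Narasimhan phase of a nonzero object. -/
def phiMinus (σ : StabilityCondition R t) (E : D) : ℝ := sInf (σ.phases E)

/-- `τ` is `ε`-close to `σ`: the extreme phases of all nonzero objects and the values of the central
charges on the basis of `N` differ by less than `ε`. -/
def IsClose (ε : ℝ) (σ τ : StabilityCondition R t) : Prop :=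
  (∀ E : D, ¬ IsZero E →
    |τ.phiPlus E - σ.phiPlus E| < ε ∧ |τ.phiMinus E - σ.phiMinus E| < ε) ∧
  open Classical in ∀ i : V, ‖τ.Z (Pi.single i 1) - σ.Z (Pi.single i 1)‖ < ε

/-- The topology of the space `Stab(D)`, induced by Bridgeland's generalized metric on slicings and
the usual topology of the vector space of central charges. -/
instance : TopologicalSpace (StabilityCondition R t) where
  IsOpen U := ∀ σ ∈ U, ∃ ε : ℝ, 0 < ε ∧ ∀ τ, IsClose ε σ τ → τ ∈ U
  isOpen_univ := fun _ _ => ⟨1, one_pos, fun _ _ => trivial⟩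
  isOpen_inter := by
    rintro U W hU hW σ ⟨h1, h2⟩
    obtain ⟨ε, hε, H⟩ := hU σ h1
    obtain ⟨η, hη, H'⟩ := hW σ h2
    refine ⟨min ε η, lt_min hε hη, fun τ hτ => ⟨H τ ?_, H' τ ?_⟩⟩
    · exact ⟨fun E hE => ⟨(hτ.1 E hE).1.trans_le (min_le_left _ _),
        (hτ.1 E hE).2.trans_le (min_le_left _ _)⟩, fun i => (hτ.2 i).trans_le (min_le_left _ _)⟩
    · exact ⟨fun E hE => ⟨(hτ.1 E hE).1.trans_le (min_le_right _ _),
        (hτ.1 E hE).2.trans_le (min_le_right _ _)⟩, fun i => (hτ.2 i).trans_le (min_le_right _ _)⟩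
  isOpen_sUnion := by
    rintro S hS σ ⟨U, hU, hσ⟩
    obtain ⟨ε, hε, H⟩ := hS U hU σ hσ
    exact ⟨ε, hε, fun τ hτ => ⟨U, hU, H τ hτ⟩⟩

/-- The wall of type II defined by an object `E`: the locus where `E ∈ P(0)`. -/
def typeIIWall (R : QuiverRelations V) (t : TStructure D) [t.Heart R.Rep] (E : D) :
    Set (StabilityCondition R t) :=
  {σ | σ.P 0 E}

/-- The set `𝒞(𝒜)` of stability conditions nearby `𝒜 = rep(Q, I)`, i.e. with `𝒜 ⊆ P(-1, 1)`. -/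
def nearby (R : QuiverRelations V) (t : TStructure D) [t.Heart R.Rep] :
    Set (StabilityCondition R t) :=
  {σ | ∀ M : R.Rep, σ.PInterval (Set.Ioo (-1) 1) (t.ιHeart.obj M)}

/-- The imaginary part `Im Z ∈ M_ℝ = Hom(N, ℝ)` of the central charge. -/
def imZ (σ : StabilityCondition R t) : (V → ℤ) →+ ℝ := Complex.imAddGroupHom.comp σ.Z

end StabilityCondition

end Stability

end

/-! The inclusion `𝒜 ⊆ P((-1, 1))` compares the slicing with the t-structure. A semistable object of
phase at most `-1` receives no map from `𝒜[k]`, `k ≥ 0`, hence lies in `D^{≥ 1}`; shifting and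
dualizing, `P(φ)` lies in `D^{≥ n}` when `φ ≤ -n` and in `D^{≤ n}` when `φ ≥ -n` (`isGE_of_P`,
`isLE_of_P`). Cutting the Harder–Narasimhan filtration of `M ∈ 𝒜` at phase `0` therefore gives a
short exact sequence `0 → T → M → F → 0` in `𝒜`, with phases of `T` in `(0, 1)` and of `F` in `(-1,
0]` (`exists_heart_split`).

With `θ = Im Z`, `θ` is positive on nonzero objects of the first kind, and nonpositive on the
second, vanishing only on `P(0)`. It follows that `𝒯(θ)` and `ℱ(θ)` are exactly `𝒜 ∩ P((0, 1))` and
`𝒜 ∩ P((-1, 0])` (`torsionPart_iff`, `torsionFreePart_iff`). The heart and `P(0)` are then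
determined by `θ` (`heart_eq_tiltedHeart`, `P_zero_iff`).

Every fibre of `F` is nonempty: with `δ` the total dimension, `Z = δ + iθ` sends nonzero
representations to the right half-plane. Slope stability for `θ/δ` then gives a slicing in which `𝒜`
has phases in `(-1/2, 1/2)` (`slopeStabilityCondition`). The torsion pair for an arbitrary `θ` is
read off from this point of the fibre.

For openness, `P((-1, 1))` is extension-closed, so `𝒜 ⊆ P((-1, 1))` need only be tested on simple
representations. There are finitely many, since each is a quotient of some `e_a (ℂQ/I)`
(`finite_simples`), and each test is an open condition on extreme phases. Finally, the signs of `θ`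
on classes of bounded total dimension define a cone on which semistability of a given object
persists; this identifies `𝒲` (`scatteringSupport_eq`). -/

noncomputable section

/-! ### The abelian category `rep(Q, I)` and additivity of dimension vectors. -/

namespace QuiverRelations

open scoped ZeroObject

variable {V : Type u} [Quiver.{v + 1} V] (R : QuiverRelations V)

/-- The action of a linear combination of paths on a representation of the quiver. -/
def pathAction (F : Paths V ⥤ FGModuleCat.{0} ℂ) {a b : V} (x : Quiver.Path a b →₀ ℂ) :
    F.obj ((Paths.of V).obj a) →ₗ[ℂ] F.obj ((Paths.of V).obj b) :=
  x.sum fun p c => c • (F.map (X := (Paths.of V).obj a) (Y := (Paths.of V).obj b) p).hom.hom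

lemma pathAction_naturality {F G : Paths V ⥤ FGModuleCat.{0} ℂ} (η : F ⟶ G) {a b : V}
    (x : Quiver.Path a b →₀ ℂ) (m : F.obj ((Paths.of V).obj a)) :
    (η.app ((Paths.of V).obj b)).hom.hom (pathAction F x m) =
      pathAction G x ((η.app ((Paths.of V).obj a)).hom.hom m) := by
  simp only [pathAction, Finsupp.sum, LinearMap.sum_apply, LinearMap.smul_apply, map_sum, map_smul]
  refine Finset.sum_congr rfl fun p _ => ?_
  congr 1
  have := η.naturality (X := (Paths.of V).obj a) (Y := (Paths.of V).obj b) p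
  exact congr($(this).hom.hom m)

lemma satisfies_iff (F : Paths V ⥤ FGModuleCat.{0} ℂ) :
    R.Satisfies F ↔ ∀ (a b : V) (x : Quiver.Path a b →₀ ℂ), x ∈ R.rel a b → pathAction F x = 0 :=
  Iff.rfl

lemma app_injective_of_mono {F G : Paths V ⥤ FGModuleCat.{0} ℂ} (η : F ⟶ G) [Mono η]
    (a : Paths V) : Function.Injective (η.app a).hom.hom := by
  have : Mono (η.app a) := inferInstance
  have := (ModuleCat.mono_iff_injective
    ((forget₂ (FGModuleCat.{0} ℂ) (ModuleCat.{0} ℂ)).map (η.app a))).1 inferInstance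
  exact this

lemma app_surjective_of_epi {F G : Paths V ⥤ FGModuleCat.{0} ℂ} (η : F ⟶ G) [Epi η]
    (a : Paths V) : Function.Surjective (η.app a).hom.hom := by
  have : Epi (η.app a) := inferInstance
  have := (ModuleCat.epi_iff_surjective
    ((forget₂ (FGModuleCat.{0} ℂ) (ModuleCat.{0} ℂ)).map (η.app a))).1 inferInstance
  exact this

instance : R.Satisfies.IsClosedUnderSubobjects where
  prop_of_mono {F G} η _ hG := by
    rw [satisfies_iff] at hG ⊢
    intro a b x hx
    ext m
    apply app_injective_of_mono η
    rw [pathAction_naturality, hG a b x hx]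
    simp

instance : R.Satisfies.IsClosedUnderQuotients where
  prop_of_epi {F G} η _ hF := by
    rw [satisfies_iff] at hF ⊢
    intro a b x hx
    ext m
    obtain ⟨m, rfl⟩ := app_surjective_of_epi η _ m
    rw [← pathAction_naturality, hF a b x hx]
    simp

instance : R.Satisfies.ContainsZero where
  exists_zero := by
    refine ⟨0, isZero_zero _, ?_⟩
    rw [satisfies_iff]
    intro a b x _
    have h : IsZero ((0 : Paths V ⥤ FGModuleCat.{0} ℂ).obj ((Paths.of V).obj b)) :=
      (isZero_zero (Paths V ⥤ FGModuleCat.{0} ℂ)).obj _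
    ext m
    have : 𝟙 ((0 : Paths V ⥤ FGModuleCat.{0} ℂ).obj ((Paths.of V).obj b)) = 0 := h.eq_of_src _ _
    exact congr($(this).hom.hom (pathAction _ x m))

/-- The identity of `F ⊞ G` is the sum of the two projections followed by the inclusions, and path
actions commute with the projections. -/
lemma satisfies_biprod (F G : Paths V ⥤ FGModuleCat.{0} ℂ) (hF : R.Satisfies F)
    (hG : R.Satisfies G) : R.Satisfies (F ⊞ G) := by
  rw [satisfies_iff] at hF hG ⊢
  intro a b x hx
  ext m
  have h := congr_app (biprod.total (X := F) (Y := G)) ((Paths.of V).obj b)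
  have h' := congr($(h).hom.hom (pathAction (F ⊞ G) x m))
  refine h'.symm.trans ?_
  change ((biprod.inl : F ⟶ F ⊞ G).app _).hom.hom (((biprod.fst : F ⊞ G ⟶ F).app _).hom.hom _) +
    ((biprod.inr : G ⟶ F ⊞ G).app _).hom.hom (((biprod.snd : F ⊞ G ⟶ G).app _).hom.hom _) = _
  rw [pathAction_naturality (biprod.fst : F ⊞ G ⟶ F),
    pathAction_naturality (biprod.snd : F ⊞ G ⟶ G), hF a b x hx, hG a b x hx]
  simp

instance : R.Satisfies.IsClosedUnderBinaryProducts where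
  limitsOfShape_le := by
    rintro X ⟨p⟩
    have e := p.isLimit.conePointUniqueUpToIso ((IsLimit.postcomposeHomEquiv
      (diagramIsoPair p.diag).symm _).symm (BinaryBiproduct.isLimit _ _))
    refine R.Satisfies.prop_of_iso e.symm ?_
    exact R.satisfies_biprod _ _ (p.prop_diag_obj _) (p.prop_diag_obj _)

instance : R.Satisfies.IsClosedUnderFiniteProducts :=
  ObjectProperty.IsClosedUnderFiniteProducts.mk'

instance : R.Satisfies.ι.PreservesMonomorphisms :=
  R.Satisfies.preservesMonomorphisms_ι_of_isNormalEpiCategory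

instance : R.Satisfies.ι.PreservesEpimorphisms :=
  R.Satisfies.preservesEpimorphisms_ι_of_isNormalMonoCategory

instance : PreservesFiniteLimits R.Satisfies.ι := by
  have := R.Satisfies.preservesKernels_ι
  exact Functor.preservesFiniteLimits_of_preservesKernels _

instance : PreservesFiniteColimits R.Satisfies.ι := by
  have := R.Satisfies.preservesCokernels_ι
  exact Functor.preservesFiniteColimits_of_preservesCokernels _

variable {R}

lemma app_injective {M N : R.Rep} (f : M ⟶ N) [Mono f] (a : Paths V) :
    Function.Injective (f.hom.app a).hom.hom := by
  have : Mono f.hom := inferInstanceAs (Mono (R.Satisfies.ι.map f))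
  exact app_injective_of_mono f.hom a

lemma app_surjective {M N : R.Rep} (f : M ⟶ N) [Epi f] (a : Paths V) :
    Function.Surjective (f.hom.app a).hom.hom := by
  have : Epi f.hom := inferInstanceAs (Epi (R.Satisfies.ι.map f))
  exact app_surjective_of_epi f.hom a

/-- The inclusion into all quiver representations and evaluation at a vertex are exact, so this is
rank–nullity vertex by vertex. -/
lemma dimVec_shortExact {S : ShortComplex R.Rep} (hS : S.ShortExact) :
    dimVec S.X₂ = dimVec S.X₁ + dimVec S.X₃ := by
  ext i
  let a : Paths V := (Paths.of V).obj i
  have h1 := (hS.map_of_exact R.Satisfies.ι).map_of_exact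
    ((CategoryTheory.evaluation (Paths V) (FGModuleCat.{0} ℂ)).obj a)
  have h2 := h1.map_of_exact (forget₂ (FGModuleCat.{0} ℂ) (ModuleCat.{0} ℂ))
  have hex := (ShortComplex.moduleCat_exact_iff_range_eq_ker _).1 h2.exact
  have := hS.mono_f
  have := hS.epi_g
  let f := (S.f.hom.app a).hom.hom
  let g := (S.g.hom.app a).hom.hom
  have hex' : LinearMap.range f = LinearMap.ker g := hex
  have hf : Function.Injective f := app_injective S.f a
  have hg : Function.Surjective g := app_surjective S.g a
  have key := LinearMap.finrank_range_add_finrank_ker g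
  rw [← hex', LinearMap.finrank_range_of_inj hf, LinearMap.range_eq_top.2 hg, finrank_top] at key
  simp only [dimVec, Pi.add_apply]
  have key' : Module.finrank ℂ (S.X₃.obj.obj a) + Module.finrank ℂ (S.X₁.obj.obj a) =
    Module.finrank ℂ (S.X₂.obj.obj a) := key
  change (Module.finrank ℂ (S.X₂.obj.obj a) : ℤ) = Module.finrank ℂ (S.X₁.obj.obj a) +
    Module.finrank ℂ (S.X₃.obj.obj a)
  lia

lemma dimVec_nonneg (M : R.Rep) (i : V) : 0 ≤ dimVec M i := by
  simp [dimVec]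

lemma dimVec_of_iso {M N : R.Rep} (e : M ≅ N) : dimVec M = dimVec N := by
  ext i
  have : (M.obj.obj ((Paths.of V).obj i)) ≅ N.obj.obj ((Paths.of V).obj i) :=
    ((CategoryTheory.evaluation (Paths V) (FGModuleCat.{0} ℂ)).obj
      ((Paths.of V).obj i)).mapIso (R.Satisfies.ι.mapIso e)
  simp [dimVec, (FGModuleCat.isoToLinearEquiv this).finrank_eq]

lemma isZero_iff_dimVec (M : R.Rep) : IsZero M ↔ dimVec M = 0 := by
  constructor
  · intro h
    -- For a zero object this sequence is short exact, and additivity gives `d(M) = d(M) + d(M)`.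
    let S : ShortComplex R.Rep := .mk (𝟙 M) (0 : M ⟶ M) (by simp)
    have hS : S.ShortExact :=
      { exact := ShortComplex.exact_of_isZero_X₂ _ h
        mono_f := inferInstanceAs (Mono (𝟙 M))
        epi_g := ⟨fun _ _ _ => h.eq_of_src _ _⟩ }
    simpa [S] using dimVec_shortExact hS
  · intro h
    rw [IsZero.iff_id_eq_zero]
    apply R.Satisfies.hom_ext
    ext a m
    have h1 : (Module.finrank ℂ (M.obj.obj a) : ℤ) = 0 := congr_fun h a
    have : Subsingleton (M.obj.obj a) := Module.finrank_zero_iff.1 (by exact_mod_cast h1)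
    exact this.elim (α := M.obj.obj a) _ _

lemma shortExact_cokernel {L M : R.Rep} (f : L ⟶ M) [Mono f] :
    (ShortComplex.mk f (cokernel.π f) (by simp)).ShortExact :=
  { exact := ShortComplex.exact_cokernel f }

lemma shortExact_kernel {M N : R.Rep} (f : M ⟶ N) [Epi f] :
    (ShortComplex.mk (kernel.ι f) f (by simp)).ShortExact :=
  { exact := ShortComplex.exact_kernel f }

lemma dimVec_cokernel {L M : R.Rep} (f : L ⟶ M) [Mono f] :
    dimVec M = dimVec L + dimVec (cokernel f) :=
  dimVec_shortExact (shortExact_cokernel f)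

lemma dimVec_kernel {M N : R.Rep} (f : M ⟶ N) [Epi f] :
    dimVec M = dimVec (kernel f) + dimVec N :=
  dimVec_shortExact (shortExact_kernel f)

lemma dimVec_le_of_mono {L M : R.Rep} (f : L ⟶ M) [Mono f] : dimVec L ≤ dimVec M := fun i => by
  have := congr_fun (dimVec_cokernel f) i
  simp only [Pi.add_apply] at this
  have := dimVec_nonneg (cokernel f) i
  lia

lemma dimVec_sub_dimVec {M N : R.Rep} (f : M ⟶ N) :
    dimVec N - dimVec M = dimVec (cokernel f) - dimVec (kernel f) := by
  have h1 := dimVec_cokernel (kernel.ι f)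
  have h2 := dimVec_kernel (cokernel.π f)
  have h3 : dimVec (cokernel (kernel.ι f)) = dimVec (kernel (cokernel.π f)) :=
    dimVec_of_iso (Abelian.coimageIsoImage f)
  rw [h1, h2, h3]
  abel

variable [Fintype V]

/-- The total dimension of a representation. -/
def totalDim (M : R.Rep) : ℤ := ∑ i, dimVec M i

lemma totalDim_nonneg (M : R.Rep) : 0 ≤ totalDim M :=
  Finset.sum_nonneg fun i _ => dimVec_nonneg M i

lemma isZero_iff_totalDim (M : R.Rep) : IsZero M ↔ totalDim M = 0 := by
  rw [isZero_iff_dimVec, totalDim, Finset.sum_eq_zero_iff_of_nonneg fun i _ => dimVec_nonneg M i]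
  exact ⟨fun h i _ => congr_fun h i, fun h => funext fun i => h i (Finset.mem_univ i)⟩

lemma totalDim_pos {M : R.Rep} (h : ¬ IsZero M) : 0 < totalDim M :=
  lt_of_le_of_ne (totalDim_nonneg M) fun h' => h ((isZero_iff_totalDim M).2 h'.symm)

lemma totalDim_shortExact {S : ShortComplex R.Rep} (hS : S.ShortExact) :
    totalDim S.X₂ = totalDim S.X₁ + totalDim S.X₃ := by
  simp [totalDim, dimVec_shortExact hS, Finset.sum_add_distrib]

end QuiverRelations

end

/-! ### The projectives `e_a (ℂQ/I)` and finiteness of the set of simple representations. -/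

noncomputable section

namespace QuiverRelations

variable {V : Type u} [Quiver.{v + 1} V] {R : QuiverRelations V}

variable (R) in
/-- Right multiplication by a path on `e_a (ℂQ/I)`. -/
def quotientMap (a : V) {b c : V} (q : Quiver.Path b c) :
    ((Quiver.Path a b →₀ ℂ) ⧸ R.rel a b) →ₗ[ℂ] ((Quiver.Path a c →₀ ℂ) ⧸ R.rel a c) :=
  Submodule.mapQ _ _ (Finsupp.lmapDomain ℂ ℂ fun p => p.comp q) fun x hx => R.comp_right x q hx

lemma quotientMap_mk_single (a : V) {b c : V} (q : Quiver.Path b c) (p : Quiver.Path a b) :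
    R.quotientMap a q (Submodule.Quotient.mk (Finsupp.single p 1)) =
      Submodule.Quotient.mk (Finsupp.single (p.comp q) 1) := by
  change Submodule.Quotient.mk (Finsupp.mapDomain _ _) = _
  rw [Finsupp.mapDomain_single]

lemma quotient_hom_ext {a b : V} {W : Type*} [AddCommGroup W] [Module ℂ W]
    {f g : ((Quiver.Path a b →₀ ℂ) ⧸ R.rel a b) →ₗ[ℂ] W}
    (h : ∀ p : Quiver.Path a b, f (Submodule.Quotient.mk (Finsupp.single p 1)) =
      g (Submodule.Quotient.mk (Finsupp.single p 1))) : f = g := by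
  refine Submodule.linearMap_qext _ (Finsupp.lhom_ext' fun p => LinearMap.ext_ring ?_)
  simpa using h p

lemma quotientMap_nil (a b : V) :
    R.quotientMap a (Quiver.Path.nil : Quiver.Path b b) = LinearMap.id :=
  quotient_hom_ext fun p => by simp [quotientMap_mk_single]

lemma quotientMap_comp (a : V) {b c d : V} (p : Quiver.Path b c) (q : Quiver.Path c d) :
    R.quotientMap a (p.comp q) = R.quotientMap a q ∘ₗ R.quotientMap a p :=
  quotient_hom_ext fun r => by simp [quotientMap_mk_single, Quiver.Path.comp_assoc]

/-- Evaluation of combinations of paths starting at `a` on a vector of a representation. -/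
def evalQuotient (M : R.Rep) {a : V} (m : M.obj.obj ((Paths.of V).obj a)) (b : V) :
    ((Quiver.Path a b →₀ ℂ) ⧸ R.rel a b) →ₗ[ℂ] M.obj.obj ((Paths.of V).obj b) :=
  Submodule.liftQ _ (Finsupp.linearCombination ℂ fun p =>
    (M.obj.map (X := (Paths.of V).obj a) (Y := (Paths.of V).obj b) p).hom.hom m) fun x hx => by
      have := M.property a b x hx
      have h := congr($this m)
      rw [LinearMap.mem_ker, Finsupp.linearCombination_apply]
      simpa [Finsupp.sum, LinearMap.sum_apply] using h

lemma evalQuotient_mk_single (M : R.Rep) {a : V} (m : M.obj.obj ((Paths.of V).obj a)) {b : V}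
    (p : Quiver.Path a b) :
    evalQuotient M m b (Submodule.Quotient.mk (Finsupp.single p 1)) =
      (M.obj.map (X := (Paths.of V).obj a) (Y := (Paths.of V).obj b) p).hom.hom m := by
  simp [evalQuotient]

lemma evalQuotient_naturality (M : R.Rep) {a : V} (m : M.obj.obj ((Paths.of V).obj a)) {b c : V}
    (q : Quiver.Path b c) :
    evalQuotient M m c ∘ₗ R.quotientMap a q =
      (M.obj.map (X := (Paths.of V).obj b) (Y := (Paths.of V).obj c) q).hom.hom ∘ₗ
        evalQuotient M m b :=
  quotient_hom_ext fun p => by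
    simp only [LinearMap.comp_apply, quotientMap_mk_single, evalQuotient_mk_single]
    have := M.obj.map_comp (X := (Paths.of V).obj a) (Y := (Paths.of V).obj b)
      (Z := (Paths.of V).obj c) p q
    exact congr($(this).hom.hom m)

variable (hR : R.IsFiniteDimensional)

-- The path spaces live in the universe of the quiver, while objects of `FGModuleCat.{0} ℂ` have
-- carriers in `Type`; coordinates move them there.
include hR in
lemma nonempty_equiv_quotient (a b : V) :
    Nonempty (((Quiver.Path a b →₀ ℂ) ⧸ R.rel a b) ≃ₗ[ℂ]
      (Fin (Module.finrank ℂ ((Quiver.Path a b →₀ ℂ) ⧸ R.rel a b)) → ℂ)) := by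
  have := hR a b
  exact ⟨LinearEquiv.ofFinrankEq _ _ (by simp)⟩

/-- Coordinates on the space of paths from `a` to `b` modulo relations. -/
def quotientEquiv (a b : V) : ((Quiver.Path a b →₀ ℂ) ⧸ R.rel a b) ≃ₗ[ℂ]
    (Fin (Module.finrank ℂ ((Quiver.Path a b →₀ ℂ) ⧸ R.rel a b)) → ℂ) :=
  (nonempty_equiv_quotient hR a b).some

/-- The functor underlying the projective representation `e_a (ℂQ/I)`. -/
def projFunctor (a : V) : Paths V ⥤ FGModuleCat.{0} ℂ where
  obj b := FGModuleCat.of ℂ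
    (Fin (Module.finrank ℂ ((Quiver.Path a (show V from b) →₀ ℂ) ⧸ R.rel a b)) → ℂ)
  map {b c} q := FGModuleCat.ofHom ((quotientEquiv hR a c).toLinearMap ∘ₗ
    R.quotientMap a (b := b) (c := c) q ∘ₗ (quotientEquiv hR a b).symm.toLinearMap)
  map_id b := by
    have : R.quotientMap a (b := b) (c := b) (𝟙 b : b ⟶ b) = LinearMap.id := quotientMap_nil a _
    refine FGModuleCat.hom_ext (LinearMap.ext fun x => ?_)
    change quotientEquiv hR a b (R.quotientMap a (b := b) (c := b) (𝟙 b : b ⟶ b)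
      ((quotientEquiv hR a b).symm x)) = x
    rw [this]
    simp
  map_comp {b c d} p q := by
    have : R.quotientMap a (b := b) (c := d) (p ≫ q) = R.quotientMap a q ∘ₗ R.quotientMap a p :=
      quotientMap_comp a _ _
    refine FGModuleCat.hom_ext (LinearMap.ext fun x => ?_)
    change quotientEquiv hR a d (R.quotientMap a (b := b) (c := d) (p ≫ q)
      ((quotientEquiv hR a b).symm x)) = quotientEquiv hR a d (R.quotientMap a q
        ((quotientEquiv hR a c).symm (quotientEquiv hR a c (R.quotientMap a p
          ((quotientEquiv hR a b).symm x)))))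
    rw [this]
    simp

/-- Acting by `x` on the class of `p` concatenates `p` with `x`. Since the ideal is closed under
this operation, `e_a (ℂQ/I)` satisfies the relations. -/
lemma pathAction_projFunctor (a : V) {b c : V} (x : Quiver.Path b c →₀ ℂ)
    (p : Quiver.Path a b) :
    (quotientEquiv hR a c).symm (pathAction (projFunctor hR a) x
      (quotientEquiv hR a b (Submodule.Quotient.mk (Finsupp.single p 1)))) =
    Submodule.Quotient.mk (Finsupp.mapDomain (fun q => p.comp q) x) := by
  have h (q : Quiver.Path b c) : (quotientEquiv hR a c).symm
      (((projFunctor hR a).map (X := (Paths.of V).obj b) (Y := (Paths.of V).obj c) q).hom.hom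
        (quotientEquiv hR a b (Submodule.Quotient.mk (Finsupp.single p 1)))) =
      Submodule.Quotient.mk (Finsupp.single (p.comp q) 1) := by
    change (quotientEquiv hR a c).symm (quotientEquiv hR a c (R.quotientMap a q
      ((quotientEquiv hR a b).symm (quotientEquiv hR a b _)))) = _
    simp [quotientMap_mk_single]
  let L₁ : (Quiver.Path b c →₀ ℂ) →ₗ[ℂ] ((Quiver.Path a c →₀ ℂ) ⧸ R.rel a c) :=
    (quotientEquiv hR a c).symm.toLinearMap ∘ₗ
      (LinearMap.applyₗ (quotientEquiv hR a b (Submodule.Quotient.mk (Finsupp.single p 1)))) ∘ₗ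
      Finsupp.linearCombination ℂ fun q => ((projFunctor hR a).map (X := (Paths.of V).obj b)
        (Y := (Paths.of V).obj c) q).hom.hom
  let L₂ : (Quiver.Path b c →₀ ℂ) →ₗ[ℂ] ((Quiver.Path a c →₀ ℂ) ⧸ R.rel a c) :=
    (R.rel a c).mkQ ∘ₗ Finsupp.lmapDomain ℂ ℂ fun q => p.comp q
  have hL : L₁ = L₂ := by
    refine Finsupp.lhom_ext' fun q => LinearMap.ext_ring ?_
    have h1 : L₁ (Finsupp.single q 1) = Submodule.Quotient.mk (Finsupp.single (p.comp q) 1) := by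
      rw [← h q]
      have h0 : Finsupp.linearCombination ℂ (fun q => ((projFunctor hR a).map
          (X := (Paths.of V).obj b) (Y := (Paths.of V).obj c) q).hom.hom) (Finsupp.single q 1) =
          ((projFunctor hR a).map (X := (Paths.of V).obj b)
            (Y := (Paths.of V).obj c) q).hom.hom := by
        refine (Finsupp.linearCombination_single ℂ _ _).trans (one_smul _ _)
      exact congr((quotientEquiv hR a c).symm
        ($h0 (quotientEquiv hR a b (Submodule.Quotient.mk (Finsupp.single p 1)))))
    have h2 : L₂ (Finsupp.single q 1) = Submodule.Quotient.mk (Finsupp.single (p.comp q) 1) := by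
      simp [L₂]
    exact h1.trans h2.symm
  exact congr($hL x)

/-- The projective representation `e_a (ℂQ/I)`. -/
def proj (a : V) : R.Rep where
  obj := projFunctor hR a
  property := by
    intro b c x hx
    change pathAction (projFunctor hR a) x = 0
    have : pathAction (projFunctor hR a) x ∘ₗ (quotientEquiv hR a b).toLinearMap = 0 :=
      quotient_hom_ext fun p => by
        have := pathAction_projFunctor hR a x p
        rw [(Submodule.Quotient.mk_eq_zero _).2 (R.comp_left p x hx)] at this
        exact (quotientEquiv hR a c).symm.map_eq_zero_iff.1 this
    refine LinearMap.ext fun m => ?_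
    obtain ⟨m, rfl⟩ := (quotientEquiv hR a b).surjective m
    exact congr($this m)

/-- The morphism from the projective representation given by a vector. -/
def projHom (M : R.Rep) {a : V} (m : M.obj.obj ((Paths.of V).obj a)) : proj hR a ⟶ M :=
  ObjectProperty.homMk
    { app b := FGModuleCat.ofHom (evalQuotient M m b ∘ₗ (quotientEquiv hR a b).symm.toLinearMap)
      naturality b c q := by
        have := evalQuotient_naturality M m (b := b) (c := c) q
        refine FGModuleCat.hom_ext (LinearMap.ext fun x => ?_)
        change evalQuotient M m c ((quotientEquiv hR a c).symm (quotientEquiv hR a c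
          (R.quotientMap a q ((quotientEquiv hR a b).symm x)))) =
          (M.obj.map q).hom.hom (evalQuotient M m b ((quotientEquiv hR a b).symm x))
        rw [LinearEquiv.symm_apply_apply]
        exact congr($this ((quotientEquiv hR a b).symm x)) }

/-- The class of the trivial path at `a` is sent to `m`. -/
lemma projHom_ne_zero (M : R.Rep) {a : V} {m : M.obj.obj ((Paths.of V).obj a)} (hm : m ≠ 0) :
    projHom hR M m ≠ 0 := by
  intro h
  apply hm
  have h1 := congr((($h).hom.app ((Paths.of V).obj a)).hom.hom
    (quotientEquiv hR a a (Submodule.Quotient.mk (Finsupp.single Quiver.Path.nil 1))))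
  have h2 : evalQuotient M m a ((quotientEquiv hR a a).symm (quotientEquiv hR a a
    (Submodule.Quotient.mk (Finsupp.single Quiver.Path.nil 1)))) = 0 := h1
  rw [LinearEquiv.symm_apply_apply, evalQuotient_mk_single] at h2
  have h3 := M.obj.map_id ((Paths.of V).obj a)
  exact (congr($(h3).hom.hom m)).symm.trans h2

lemma exists_ne_zero {M : R.Rep} (hM : ¬ IsZero M) :
    ∃ (a : V) (m : M.obj.obj ((Paths.of V).obj a)), m ≠ 0 := by
  by_contra! h
  apply hM
  rw [isZero_iff_dimVec]
  ext a
  have : Subsingleton (M.obj.obj ((Paths.of V).obj a)) := ⟨fun x y => by rw [h a x, h a y]⟩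
  simpa [dimVec] using Module.finrank_zero_of_subsingleton

variable [Fintype V]

/-- Fix one nonzero map `f₀ : M ⟶ S₀` to a simple object. Any other either kills `kernel f₀`, so
that its target is `S₀` by Schur's lemma, or is nonzero on `kernel f₀`, which has smaller dimension.
-/
lemma finite_simple_targets (n : ℕ) (M : R.Rep) (hM : totalDim M ≤ n) :
    ∃ s : Set R.Rep, s.Finite ∧ (∀ X ∈ s, Simple X) ∧
      ∀ (S : R.Rep) (f : M ⟶ S), Simple S → f ≠ 0 → ∃ X ∈ s, Nonempty (X ≅ S) := by
  induction n generalizing M with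
  | zero =>
    have : IsZero M := (isZero_iff_totalDim M).2 (le_antisymm (by simpa using hM) (totalDim_nonneg M))
    exact ⟨∅, by simp, by simp, fun S f _ hf => (hf (this.eq_of_src _ _)).elim⟩
  | succ n ih =>
    by_cases h : ∃ (S : R.Rep) (f : M ⟶ S), Simple S ∧ f ≠ 0
    · obtain ⟨S₀, f₀, hS₀, hf₀⟩ := h
      have : Epi f₀ := epi_of_nonzero_to_simple hf₀
      have h1 := totalDim_shortExact (shortExact_kernel f₀)
      have h2 := totalDim_pos (Simple.not_isZero S₀)
      obtain ⟨s, hs, hs', H⟩ := ih (kernel f₀) (by dsimp at h1; push_cast at hM; lia)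
      refine ⟨insert S₀ s, hs.insert _, ?_, fun S f hS hf => ?_⟩
      · rintro X (rfl | hX)
        exacts [hS₀, hs' X hX]
      · by_cases hz : kernel.ι f₀ ≫ f = 0
        · let g : S₀ ⟶ S := Abelian.epiDesc f₀ f hz
          have hg : g ≠ 0 := fun h0 => hf (by
            rw [← Abelian.comp_epiDesc f₀ f hz]
            change f₀ ≫ g = 0
            rw [h0, comp_zero])
          have := isIso_of_hom_simple hg
          exact ⟨S₀, Set.mem_insert _ _, ⟨asIso g⟩⟩
        · obtain ⟨X, hX, e⟩ := H S _ hS hz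
          exact ⟨X, Set.mem_insert_of_mem _ hX, e⟩
    · push Not at h
      exact ⟨∅, by simp, by simp, fun S f hS hf => (hf (h S f hS)).elim⟩

include hR in
/-- A finite-dimensional algebra has finitely many simple modules. -/
lemma finite_simples : ∃ s : Set R.Rep, s.Finite ∧ (∀ X ∈ s, Simple X) ∧
    ∀ S : R.Rep, Simple S → ∃ X ∈ s, Nonempty (X ≅ S) := by
  choose s hs hs' H using fun a : V =>
    finite_simple_targets _ (proj hR a) (Int.self_le_toNat (totalDim (proj hR a)))
  refine ⟨⋃ a, s a, Set.finite_iUnion hs, ?_, fun S hS => ?_⟩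
  · simp only [Set.mem_iUnion, forall_exists_index]
    exact fun X a hX => hs' a X hX
  · obtain ⟨a, m, hm⟩ := exists_ne_zero (Simple.not_isZero S)
    obtain ⟨X, hX, e⟩ := H a S (projHom hR S m) hS (projHom_ne_zero hR S hm)
    exact ⟨X, Set.mem_iUnion.2 ⟨a, hX⟩, e⟩

/-- A class of representations that is closed under isomorphisms and extensions and contains the
zero objects and the simple objects contains all representations. -/
lemma induction_simple (Q : R.Rep → Prop) (zero : ∀ M, IsZero M → Q M) (simple : ∀ S, Simple S → Q S)
    (ext : ∀ S : ShortComplex R.Rep, S.ShortExact → Q S.X₁ → Q S.X₃ → Q S.X₂) (M : R.Rep) : Q M := by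
  obtain ⟨n, hn⟩ : ∃ n : ℕ, totalDim M ≤ n := ⟨_, Int.self_le_toNat _⟩
  induction n generalizing M with
  | zero => exact zero M ((isZero_iff_totalDim M).2 (le_antisymm (by simpa using hn) (totalDim_nonneg M)))
  | succ n ih =>
    by_cases hM : IsZero M
    · exact zero M hM
    by_cases hS : Simple M
    · exact simple M hS
    obtain ⟨L, f, hf, hf0, hfi⟩ : ∃ (L : R.Rep) (f : L ⟶ M), Mono f ∧ f ≠ 0 ∧ ¬ IsIso f := by
      by_contra! h
      refine hS ⟨fun {L} f _ => ⟨fun hi h0 => hM ?_, fun h0 => h _ f inferInstance h0⟩⟩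
      subst h0
      rw [IsZero.iff_id_eq_zero, ← cancel_epi (0 : L ⟶ M)]
      simp
    have h1 := totalDim_shortExact (shortExact_cokernel f)
    dsimp at h1
    push_cast at hn
    have h2 : 0 < totalDim L := totalDim_pos fun h => hf0 (h.eq_of_src _ _)
    have h3 : 0 < totalDim (cokernel f) := totalDim_pos fun h => hfi <| by
      have := Abelian.epi_of_cokernel_π_eq_zero f (h.eq_of_tgt _ _)
      exact isIso_of_mono_of_epi f
    exact ext _ (shortExact_cokernel f) (ih L (by lia)) (ih (cokernel f) (by lia))

end QuiverRelations

end

/-! ### Distinguished triangles and the abelian structure of the heart. -/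

noncomputable section

open Triangulated

variable {D : Type u'} [Category.{v'} D] [Preadditive D] [HasZeroObject D] [HasShift D ℤ]
  [∀ n : ℤ, (shiftFunctor D n).Additive] [Pretriangulated D]

/-- There is a distinguished triangle `X ⟶ Y ⟶ Z ⟶ X⟦1⟧`. -/
def HasTriangle (X Y Z : D) : Prop :=
  ∃ (f : X ⟶ Y) (g : Y ⟶ Z) (h : Z ⟶ X⟦(1 : ℤ)⟧), Triangle.mk f g h ∈ distTriang D

namespace HasTriangle

variable {X Y Z X' Y' Z' W : D}

lemma of_mem (T : Triangle D) (hT : T ∈ distTriang D) : HasTriangle T.obj₁ T.obj₂ T.obj₃ :=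
  ⟨_, _, _, hT⟩

lemma of_iso (H : HasTriangle X Y Z) (e₁ : X ≅ X') (e₂ : Y ≅ Y') (e₃ : Z ≅ Z') :
    HasTriangle X' Y' Z' := by
  obtain ⟨f, g, h, H⟩ := H
  refine ⟨e₁.inv ≫ f ≫ e₂.hom, e₂.inv ≫ g ≫ e₃.hom, e₃.inv ≫ h ≫ e₁.hom⟦(1 : ℤ)⟧',
    isomorphic_distinguished _ H _ ?_⟩
  exact Triangle.isoMk _ _ e₁.symm e₂.symm e₃.symm (by simp [Triangle.mk])
    (by simp [Triangle.mk]) (by simp [Triangle.mk, ← Functor.map_comp])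

lemma rotate (H : HasTriangle X Y Z) : HasTriangle Y Z (X⟦(1 : ℤ)⟧) := by
  obtain ⟨f, g, h, H⟩ := H
  exact of_mem _ (rot_of_distTriang _ H)

lemma invRotate (H : HasTriangle X Y Z) : HasTriangle (Z⟦(-1 : ℤ)⟧) X Y := by
  obtain ⟨f, g, h, H⟩ := H
  exact of_mem _ (inv_rot_of_distTriang _ H)

lemma shift (H : HasTriangle X Y Z) (n : ℤ) : HasTriangle (X⟦n⟧) (Y⟦n⟧) (Z⟦n⟧) := by
  obtain ⟨f, g, h, H⟩ := H
  exact of_mem _ (Triangle.shift_distinguished _ H n)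

lemma of_isZero₁ (hX : IsZero X) (e : Y ≅ Z) : HasTriangle X Y Z :=
  (of_mem _ (contractible_distinguished₁ Y)).of_iso (isZero_zero D |>.iso hX) (Iso.refl _) e

lemma of_isZero₃ (hZ : IsZero Z) (e : X ≅ Y) : HasTriangle X Y Z :=
  (of_mem _ (contractible_distinguished X)).of_iso (Iso.refl _) e (isZero_zero D |>.iso hZ)

lemma iso_of_isZero₁ (H : HasTriangle X Y Z) (hX : IsZero X) : Nonempty (Y ≅ Z) := by
  obtain ⟨f, g, h, H⟩ := H
  have : IsIso g := (Triangle.isZero₁_iff_isIso₂ _ H).1 hX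
  exact ⟨asIso g⟩

lemma iso_of_isZero₃ (H : HasTriangle X Y Z) (hZ : IsZero Z) : Nonempty (X ≅ Y) := by
  obtain ⟨f, g, h, H⟩ := H
  have : IsIso f := (Triangle.isZero₃_iff_isIso₁ _ H).1 hZ
  exact ⟨asIso f⟩

lemma hom_from_eq_zero (H : HasTriangle X Y Z) (h₁ : ∀ f : W ⟶ X, f = 0) (h₃ : ∀ f : W ⟶ Z, f = 0)
    (f : W ⟶ Y) : f = 0 := by
  obtain ⟨a, b, c, H⟩ := H
  obtain ⟨g, hg⟩ : ∃ g : W ⟶ X, f = g ≫ a := Triangle.coyoneda_exact₂ _ H f (h₃ _)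
  rw [hg, h₁ g, zero_comp]

lemma hom_to_eq_zero (H : HasTriangle X Y Z) (h₁ : ∀ f : X ⟶ W, f = 0) (h₃ : ∀ f : Z ⟶ W, f = 0)
    (f : Y ⟶ W) : f = 0 := by
  obtain ⟨a, b, c, H⟩ := H
  obtain ⟨g, hg⟩ : ∃ g : Z ⟶ W, f = b ≫ g := Triangle.yoneda_exact₂ _ H f (h₁ _)
  rw [hg, h₃ g, comp_zero]

section

variable [IsTriangulated D]

/-- The octahedral axiom, read as `(E/A)/(Y/A) = E/Y`; it and its companion below regroup
filtrations. -/
lemma exists_quotient {A B C E : D} (H₁ : HasTriangle A Y B) (H₂ : HasTriangle Y E C) :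
    ∃ Q, HasTriangle A E Q ∧ HasTriangle B Q C := by
  obtain ⟨f, g, h, H₁⟩ := H₁
  obtain ⟨f', g', h', H₂⟩ := H₂
  obtain ⟨Q, p, q, H₃⟩ := distinguished_cocone_triangle (f ≫ f')
  exact ⟨Q, of_mem _ H₃, of_mem _ (someOctahedron rfl H₁ H₂ H₃).mem⟩

lemma exists_sub {A B C E Q : D} (H₁ : HasTriangle A E Q) (H₂ : HasTriangle B Q C) :
    ∃ Y, HasTriangle A Y B ∧ HasTriangle Y E C := by
  obtain ⟨f, g, h, H₁⟩ := H₁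
  obtain ⟨f', g', h', H₂⟩ := H₂
  obtain ⟨Y, p, q, H₃⟩ := distinguished_cocone_triangle₁ (g ≫ g')
  exact ⟨Y, of_mem _ (someOctahedron' rfl H₁ H₂ H₃).mem, of_mem _ H₃⟩

end

section TStructure

variable (t : TStructure D) (n : ℤ)

lemma isLE₂ (H : HasTriangle X Y Z) (h₁ : t.IsLE X n) (h₃ : t.IsLE Z n) : t.IsLE Y n := by
  obtain ⟨f, g, h, H⟩ := H
  exact t.isLE₂ _ H n h₁ h₃

lemma isGE₂ (H : HasTriangle X Y Z) (h₁ : t.IsGE X n) (h₃ : t.IsGE Z n) : t.IsGE Y n := by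
  obtain ⟨f, g, h, H⟩ := H
  exact t.isGE₂ _ H n h₁ h₃

lemma isGE₁ (H : HasTriangle X Y Z) (h₂ : t.IsGE Y n) (h₃ : t.IsGE Z (n - 1)) : t.IsGE X n :=
  H.invRotate.isGE₂ t n (t.isGE_shift Z (n - 1) (-1) n) h₂

lemma isLE₃ (H : HasTriangle X Y Z) (h₁ : t.IsLE X (n + 1)) (h₂ : t.IsLE Y n) : t.IsLE Z n :=
  H.rotate.isLE₂ t n h₂ (t.isLE_shift X (n + 1) 1 n)

lemma isGE₃ (H : HasTriangle X Y Z) (h₁ : t.IsGE X (n + 1)) (h₂ : t.IsGE Y n) : t.IsGE Z n :=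
  H.rotate.isGE₂ t n h₂ (t.isGE_shift X (n + 1) 1 n)

end TStructure

end HasTriangle

namespace CategoryTheory.Triangulated.TStructure

variable (t : TStructure D)

lemma hasTriangle_trunc (X : D) (n : ℤ) :
    HasTriangle ((t.truncLT n).obj X) X ((t.truncGE n).obj X) :=
  .of_mem _ (t.triangleLTGE_distinguished n X)

lemma exists_bounds (ht : ∀ E : D, t.bounded E) (E : D) :
    ∃ a b : ℤ, t.IsGE E a ∧ t.IsLE E b := by
  obtain ⟨⟨a, ha⟩, ⟨b, hb⟩⟩ := ht E
  exact ⟨a, b, ha, hb⟩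

section Heart

variable {A : Type u} [Category.{v} A] [Preadditive A] [t.Heart A]

variable (A) in
lemma exists_heart_iso (X : D) (h : t.IsLE X 0) (h' : t.IsGE X 0) :
    ∃ M : A, Nonempty (t.ιHeart.obj M ≅ X) := by
  have hX : (t.ιHeart (H := A)).essImage X := by
    rw [t.essImage_ιHeart A]
    exact (t.mem_heart_iff X).2 ⟨h, h'⟩
  exact ⟨_, ⟨Functor.essImage.getIso hX⟩⟩

variable (A) in
lemma exists_heart_shift_iso (X : D) (n : ℤ) (h : t.IsLE X n) (h' : t.IsGE X n) :
    ∃ M : A, Nonempty ((t.ιHeart.obj M)⟦-n⟧ ≅ X) := by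
  obtain ⟨M, ⟨e⟩⟩ := t.exists_heart_iso A (X⟦n⟧) (t.isLE_shift X n n 0) (t.isGE_shift X n n 0)
  exact ⟨M, ⟨(shiftFunctor D (-n)).mapIso e ≪≫ (shiftEquiv D n).unitIso.symm.app X⟩⟩

lemma isLE_heart_shift (M : A) (n : ℤ) : t.IsLE ((t.ιHeart.obj M)⟦n⟧) (-n) :=
  t.isLE_shift _ 0 n (-n)

lemma isGE_heart_shift (M : A) (n : ℤ) : t.IsGE ((t.ιHeart.obj M)⟦n⟧) (-n) :=
  t.isGE_shift _ 0 n (-n)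

lemma heart_hom_shift_eq_zero ⦃X Y : A⦄ ⦃n : ℤ⦄ (f : t.ιHeart.obj X ⟶ (t.ιHeart.obj Y)⟦n⟧)
    (hn : n < 0) : f = 0 := by
  have := t.isGE_heart_shift Y n
  exact t.zero f 0 (-n)

/-- The cone of a morphism of the heart lies in degrees `-1` and `0`. Its truncation triangle splits
it into an object of the heart shifted by `1` and an object of the heart: the future kernel and
cokernel. -/
lemma admissibleMorphism_eq_top :
    AbelianSubcategory.admissibleMorphism (t.ιHeart (H := A)) = ⊤ := by
  ext X₁ X₂ f₁
  simp only [MorphismProperty.top_apply, iff_true]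
  intro X₃ f₂ f₃ hT
  have H : HasTriangle (t.ιHeart.obj X₁) (t.ιHeart.obj X₂) X₃ := ⟨_, _, _, hT⟩
  have h1 : t.IsLE X₃ 0 := H.isLE₃ t 0 (t.isLE_of_le _ 0 _) inferInstance
  have h2 : t.IsGE X₃ (-1) := H.isGE₃ t (-1) (inferInstanceAs (t.IsGE _ 0)) (t.isGE_of_ge _ _ 0)
  have h4 := t.hasTriangle_trunc X₃ 0
  have h5 : t.IsLE ((t.truncLT 0).obj X₃) (-1) := t.isLE_truncLT_obj _ _ _
  have h6 : t.IsGE ((t.truncGE 0).obj X₃) 0 := inferInstance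
  obtain ⟨K, ⟨eK⟩⟩ := t.exists_heart_shift_iso A ((t.truncLT 0).obj X₃) (-1) h5
    (h4.isGE₁ t (-1) h2 (t.isGE_of_ge _ _ 0))
  obtain ⟨Q, ⟨eQ⟩⟩ := t.exists_heart_iso A ((t.truncGE 0).obj X₃)
    (h4.isLE₃ t 0 (t.isLE_of_le _ (-1) _) h1) h6
  obtain ⟨a, b, c, h⟩ := h4.of_iso eK.symm (Iso.refl _) eQ.symm
  exact ⟨K, Q, a, b, c, h⟩

end Heart

section AbelianHeart

variable {A : Type u} [Category.{v} A] [Abelian A] [t.Heart A]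

lemma isZero_heart_iff (M : A) : IsZero (t.ιHeart.obj M : D) ↔ IsZero M := by
  refine ⟨fun h => ?_, fun h => Functor.map_isZero _ h⟩
  rw [IsZero.iff_id_eq_zero]
  exact t.ιHeart.map_injective (h.eq_of_src _ _)

omit [HasZeroObject D] [Pretriangulated D] in
lemma isZero_shift_iff (X : D) (n : ℤ) : IsZero (X⟦n⟧) ↔ IsZero X :=
  ⟨fun h => (Functor.map_isZero (shiftFunctor D (-n)) h).of_iso ((shiftEquiv D n).unitIso.app X),
    fun h => Functor.map_isZero _ h⟩

lemma hasTriangle_of_shortExact {S : ShortComplex A} (hS : S.ShortExact) :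
    HasTriangle (t.ιHeart.obj S.X₁) (t.ιHeart.obj S.X₂) (t.ιHeart.obj S.X₃ : D) := by
  have := hS.epi_g
  obtain ⟨K, i, δ, hT⟩ := AbelianSubcategory.exists_distinguished_triangle_of_epi
    t.heart_hom_shift_eq_zero t.admissibleMorphism_eq_top S.g
  let e : K ≅ S.X₁ := (AbelianSubcategory.isLimitKernelForkOfDistTriang
    t.heart_hom_shift_eq_zero i S.g δ hT).conePointUniqueUpToIso hS.fIsKernel
  exact (HasTriangle.of_mem _ hT).of_iso (t.ιHeart.mapIso e) (Iso.refl _) (Iso.refl _)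

lemma exists_shortExact_of_hasTriangle {X Y Z : A}
    (H : HasTriangle (t.ιHeart.obj X) (t.ιHeart.obj Y) (t.ιHeart.obj Z : D)) :
    ∃ (f : X ⟶ Y) (g : Y ⟶ Z) (w : f ≫ g = 0), (ShortComplex.mk f g w).ShortExact := by
  obtain ⟨f, g, h, hT⟩ := H
  obtain ⟨f, rfl⟩ := t.ιHeart.map_surjective f
  obtain ⟨g, rfl⟩ := t.ιHeart.map_surjective g
  have h1 := AbelianSubcategory.isLimitKernelForkOfDistTriang t.heart_hom_shift_eq_zero f g h hT
  have h2 := AbelianSubcategory.isColimitCokernelCoforkOfDistTriang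
    t.heart_hom_shift_eq_zero f g h hT
  have hw : f ≫ g = 0 := t.ιHeart.map_injective <|
    (t.ιHeart.map_comp f g).trans <|
      (comp_distTriang_mor_zero₁₂ _ hT).trans (t.ιHeart.map_zero X Z).symm
  refine ⟨f, g, hw, ?_⟩
  exact { exact := ShortComplex.exact_of_f_is_kernel _ h1
          mono_f := Fork.IsLimit.mono h1
          epi_g := Cofork.IsColimit.epi h2 }

lemma hasTriangle_kernel_cokernel {X Y : A} {Z : D}
    (H : HasTriangle (t.ιHeart.obj X) (t.ιHeart.obj Y) Z) :
    ∃ f : X ⟶ Y, HasTriangle ((t.ιHeart.obj (kernel f))⟦(1 : ℤ)⟧) Z (t.ιHeart.obj (cokernel f)) := by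
  obtain ⟨f, g, h, hT⟩ := H
  obtain ⟨f, rfl⟩ := t.ιHeart.map_surjective f
  have hf : AbelianSubcategory.admissibleMorphism t.ιHeart f := by
    rw [t.admissibleMorphism_eq_top]
    trivial
  obtain ⟨K, Q, α, β, γ, hT'⟩ := hf g h hT
  let e₁ := (AbelianSubcategory.isLimitKernelFork t.heart_hom_shift_eq_zero hT
    hT').conePointUniqueUpToIso (kernelIsKernel f)
  let e₂ := (AbelianSubcategory.isColimitCokernelCofork t.heart_hom_shift_eq_zero hT
    hT').coconePointUniqueUpToIso (cokernelIsCokernel f)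
  exact ⟨f, (HasTriangle.of_mem _ hT').of_iso ((shiftFunctor D 1).mapIso (t.ιHeart.mapIso e₁))
    (Iso.refl _) (t.ιHeart.mapIso e₂)⟩

end AbelianHeart

end CategoryTheory.Triangulated.TStructure

end

/-! ### Cohomology objects and dimension vectors in the triangulated category. -/

noncomputable section

open Triangulated

variable {D : Type u'} [Category.{v'} D] [Preadditive D] [HasZeroObject D] [HasShift D ℤ]
  [∀ n : ℤ, (shiftFunctor D n).Additive] [Pretriangulated D]

namespace CategoryTheory.Triangulated.TStructure

variable (t : TStructure D)

/-- Truncation triangles are unique up to isomorphism, which lets cohomology be computed from any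
suitable triangle. -/
lemma nonempty_iso_trunc {X Y E : D} (H : HasTriangle X E Y) (n : ℤ) (hX : t.IsLE X (n - 1))
    (hY : t.IsGE Y n) :
    Nonempty (X ≅ (t.truncLT n).obj E) ∧ Nonempty (Y ≅ (t.truncGE n).obj E) := by
  obtain ⟨f, g, h, H⟩ := H
  obtain ⟨e, -⟩ := t.triangle_iso_exists H (t.triangleLTGE_distinguished n E) (Iso.refl _)
    (n - 1) n hX hY inferInstance inferInstance
  exact ⟨⟨Triangle.π₁.mapIso e⟩, ⟨Triangle.π₃.mapIso e⟩⟩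

lemma isZero_truncGELE_of_isLE (E : D) (n i : ℤ) (hE : t.IsLE E n) (hi : n < i) :
    IsZero ((t.truncGELE i i).obj E) := by
  have h : t.IsLE E (i - 1) := t.isLE_of_le _ n _
  have h' : t.IsLE ((t.truncLE i).obj E) (i - 1) := inferInstance
  exact t.isZero_truncGE_obj_of_isLE (i - 1) i (by lia) _

lemma isZero_truncGELE_of_isGE (E : D) (n i : ℤ) (hE : t.IsGE E n) (hi : i < n) :
    IsZero ((t.truncGELE i i).obj E) := by
  have h : t.IsGE E (i + 1) := t.isGE_of_ge _ _ n
  exact Functor.map_isZero (t.truncGE i) (t.isZero_truncLE_obj_of_isGE i (i + 1) rfl E)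

lemma nonempty_truncGELE_iso_of_isLE (E : D) (i : ℤ) (hE : t.IsLE E i) :
    Nonempty ((t.truncGELE i i).obj E ≅ (t.truncGE i).obj E) :=
  ⟨(t.truncGE i).mapIso (asIso ((t.truncLEι i).app E))⟩

lemma isLE_of_isZero_truncGELE (E : D) (i : ℤ) (hE : t.IsLE E i)
    (h : IsZero ((t.truncGELE i i).obj E)) : t.IsLE E (i - 1) := by
  obtain ⟨e⟩ := t.nonempty_truncGELE_iso_of_isLE E i hE
  exact (t.isLE_iff_isZero_truncGE_obj (i - 1) i (by lia) E).2 (h.of_iso e.symm)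

variable [IsTriangulated D]

lemma nonempty_truncGELE_iso_of_isGE (E : D) (i : ℤ) (hE : t.IsGE E i) :
    Nonempty ((t.truncGELE i i).obj E ≅ (t.truncLE i).obj E) := by
  have : t.IsGE ((t.truncLE i).obj E) i := inferInstance
  exact ⟨(asIso ((t.truncGEπ i).app ((t.truncLE i).obj E))).symm⟩

lemma isGE_of_isZero_truncGELE (E : D) (i : ℤ) (hE : t.IsGE E i)
    (h : IsZero ((t.truncGELE i i).obj E)) : t.IsGE E (i + 1) := by
  obtain ⟨e⟩ := t.nonempty_truncGELE_iso_of_isGE E i hE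
  exact (t.isGE_iff_isZero_truncLE_obj i (i + 1) rfl E).2 (h.of_iso e.symm)

section Heart

variable {A : Type u} [Category.{v} A] [Abelian A] [t.Heart A]

variable (A) in
/-- The defining isomorphism of the cohomology objects. -/
def heartCohomologyIso (i : ℤ) (E : D) :
    t.ιHeart.obj (heartCohomology t A i E) ≅ ((t.truncGELE i i).obj E)⟦i⟧ :=
  Functor.essImage.getIso _

lemma isZero_heartCohomology_iff (i : ℤ) (E : D) :
    IsZero (heartCohomology t A i E) ↔ IsZero ((t.truncGELE i i).obj E) := by
  rw [← t.isZero_heart_iff, (t.heartCohomologyIso A i E).isZero_iff, isZero_shift_iff]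

lemma isZero_heartCohomology_of_isLE (E : D) (n i : ℤ) (hE : t.IsLE E n) (hi : n < i) :
    IsZero (heartCohomology t A i E) :=
  (t.isZero_heartCohomology_iff i E).2 (t.isZero_truncGELE_of_isLE E n i hE hi)

lemma isZero_heartCohomology_of_isGE (E : D) (n i : ℤ) (hE : t.IsGE E n) (hi : i < n) :
    IsZero (heartCohomology t A i E) :=
  (t.isZero_heartCohomology_iff i E).2 (t.isZero_truncGELE_of_isGE E n i hE hi)

lemma nonempty_iso_heartCohomology (M : A) (i : ℤ) (E : D)
    (e : (t.ιHeart.obj M)⟦-i⟧ ≅ (t.truncGELE i i).obj E) :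
    Nonempty (M ≅ heartCohomology t A i E) :=
  ⟨t.ιHeart.preimageIso ((shiftEquiv D (-i)).unitIso.app _ ≪≫
    eqToIso (by simp [shiftEquiv]) ≪≫
    (shiftFunctor D i).mapIso e ≪≫ (t.heartCohomologyIso A i E).symm)⟩

lemma nonempty_iso_heartCohomology_shift (M : A) (i : ℤ) :
    Nonempty (M ≅ heartCohomology t A i ((t.ιHeart.obj M)⟦-i⟧)) := by
  have h1 := t.isLE_heart_shift M (-i)
  have h2 := t.isGE_heart_shift M (-i)
  rw [neg_neg] at h1 h2
  obtain ⟨e⟩ := t.nonempty_truncGELE_iso_of_isLE _ i h1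
  exact t.nonempty_iso_heartCohomology M i _ (asIso ((t.truncGEπ i).app _) ≪≫ e.symm)

lemma nonempty_iso_heartCohomology_of_hasTriangle {K Q : A} {E : D}
    (H : HasTriangle ((t.ιHeart.obj K)⟦(1 : ℤ)⟧) E (t.ιHeart.obj Q)) :
    t.IsGE E (-1) ∧ t.IsLE E 0 ∧ Nonempty (K ≅ heartCohomology t A (-1) E) ∧
      Nonempty (Q ≅ heartCohomology t A 0 E) := by
  have hK := t.isLE_heart_shift K 1
  have hK' := t.isGE_heart_shift K 1
  have h1 : t.IsGE E (-1) := H.isGE₂ t (-1) hK' (t.isGE_of_ge _ _ 0)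
  have h2 : t.IsLE E 0 := H.isLE₂ t 0 (t.isLE_of_le _ (-1) _) inferInstance
  obtain ⟨⟨e₁⟩, ⟨e₂⟩⟩ := t.nonempty_iso_trunc H 0 hK inferInstance
  obtain ⟨e₃⟩ := t.nonempty_truncGELE_iso_of_isGE E (-1) h1
  obtain ⟨e₄⟩ := t.nonempty_truncGELE_iso_of_isLE E 0 h2
  refine ⟨h1, h2, t.nonempty_iso_heartCohomology K (-1) E ?_,
    t.nonempty_iso_heartCohomology Q 0 E ?_⟩
  · exact e₁ ≪≫ (t.truncLEIsoTruncLT (-1) 0 (by lia)).symm.app E ≪≫ e₃.symm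
  · exact (shiftFunctorZero' D (-0 : ℤ) (by simp)).app _ ≪≫ e₂ ≪≫ e₄.symm

/-- Boundedness provides some upper degree to start from; each vanishing top cohomology object
lowers it by one. -/
lemma isLE_of_isZero_heartCohomology (ht : ∀ E : D, t.bounded E) (E : D) (n : ℤ)
    (h : ∀ i, n < i → IsZero (heartCohomology t A i E)) : t.IsLE E n := by
  obtain ⟨a, b, -, hb⟩ := t.exists_bounds ht E
  obtain ⟨k, hk⟩ : ∃ k : ℕ, b ≤ n + k := ⟨(b - n).toNat, by lia⟩
  have hb' : t.IsLE E (n + k) := t.isLE_of_le _ b _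
  clear hk hb
  induction k with
  | zero => simpa using hb'
  | succ k ih =>
    apply ih
    have := t.isLE_of_isZero_truncGELE E _ hb'
      ((t.isZero_heartCohomology_iff _ E).1 (h _ (by push_cast; lia)))
    exact t.isLE_of_le _ (n + (k + 1 : ℕ) - 1) _ (by push_cast; lia)

lemma isGE_of_isZero_heartCohomology (ht : ∀ E : D, t.bounded E) (E : D) (n : ℤ)
    (h : ∀ i, i < n → IsZero (heartCohomology t A i E)) : t.IsGE E n := by
  obtain ⟨a, b, ha, -⟩ := t.exists_bounds ht E
  obtain ⟨k, hk⟩ : ∃ k : ℕ, n - k ≤ a := ⟨(n - a).toNat, by lia⟩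
  have ha' : t.IsGE E (n - k) := t.isGE_of_ge _ _ a
  clear hk ha
  induction k with
  | zero => simpa using ha'
  | succ k ih =>
    apply ih
    have := t.isGE_of_isZero_truncGELE E _ ha'
      ((t.isZero_heartCohomology_iff _ E).1 (h _ (by push_cast; lia)))
    exact t.isGE_of_ge _ _ (n - (k + 1 : ℕ) + 1) (by push_cast; lia)

/-- An object concentrated in degrees `-1` and `0` is an extension of its cohomology objects. -/
lemma hasTriangle_heartCohomology (E : D) (h1 : t.IsGE E (-1)) (h2 : t.IsLE E 0) :
    HasTriangle ((t.ιHeart.obj (heartCohomology t A (-1) E))⟦(1 : ℤ)⟧) E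
      (t.ιHeart.obj (heartCohomology t A 0 E)) := by
  have h4 := t.hasTriangle_trunc E 0
  have h5 : t.IsLE ((t.truncLT 0).obj E) (-1) := t.isLE_truncLT_obj _ _ _
  have h6 : t.IsGE ((t.truncGE 0).obj E) 0 := inferInstance
  obtain ⟨K, ⟨eK⟩⟩ := t.exists_heart_shift_iso A ((t.truncLT 0).obj E) (-1) h5
    (h4.isGE₁ t (-1) h1 (t.isGE_of_ge _ _ 0))
  obtain ⟨Q, ⟨eQ⟩⟩ := t.exists_heart_iso A ((t.truncGE 0).obj E)
    (h4.isLE₃ t 0 (t.isLE_of_le _ (-1) _) h2) h6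
  have H : HasTriangle ((t.ιHeart.obj K)⟦(1 : ℤ)⟧) E (t.ιHeart.obj Q) :=
    h4.of_iso eK.symm (Iso.refl _) eQ.symm
  obtain ⟨-, -, ⟨e₁⟩, ⟨e₂⟩⟩ := t.nonempty_iso_heartCohomology_of_hasTriangle H
  exact H.of_iso ((shiftFunctor D 1).mapIso (t.ιHeart.mapIso e₁)) (Iso.refl _)
    (t.ιHeart.mapIso e₂)

omit [IsTriangulated D] in
/-- Every bounded object is an iterated extension of shifts of objects of the heart. -/
lemma induction_heart (Q : D → Prop) (zero : ∀ E, IsZero E → Q E) (a b : ℤ)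
    (heart : ∀ (M : A) (i : ℤ) (E : D), a ≤ i → i ≤ b → ((t.ιHeart.obj M)⟦-i⟧ ≅ E) → Q E)
    (ext : ∀ X E Y : D, HasTriangle X E Y → Q X → Q Y → Q E)
    (E : D) (ha : t.IsGE E a) (hb : t.IsLE E b) : Q E := by
  obtain ⟨k, hk⟩ : ∃ k : ℕ, b < a + k := ⟨(b - a + 1).toNat, by lia⟩
  induction k generalizing b E with
  | zero => exact zero E (t.isZero E b a)
  | succ k ih =>
    have h4 := t.hasTriangle_trunc E b
    have h5 : t.IsLE ((t.truncLT b).obj E) (b - 1) := inferInstance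
    have h6 : t.IsGE ((t.truncGE b).obj E) b := inferInstance
    by_cases hab : a ≤ b
    · have h7 : t.IsGE ((t.truncLT b).obj E) a := by
        refine h4.isGE₁ t a ha (t.isGE_of_ge _ _ b)
      have h8 : t.IsLE ((t.truncGE b).obj E) b := by
        refine h4.isLE₃ t b (t.isLE_of_le _ (b - 1) _) hb
      obtain ⟨M, ⟨e⟩⟩ := t.exists_heart_shift_iso A ((t.truncGE b).obj E) b h8 h6
      exact ext _ _ _ h4 (ih (b - 1) (fun M i E h h' e => heart M i E h (by lia) e) _ h7 h5
        (by push_cast at hk; lia)) (heart M b _ hab le_rfl e)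
    · exact zero E (t.isZero E b a)

end Heart

section Rep

variable {V : Type u} [Quiver.{v + 1} V] (R : QuiverRelations V) [t.Heart R.Rep]

lemma dimVecD_of_hasTriangle {K Q : R.Rep} {E : D}
    (H : HasTriangle ((t.ιHeart.obj K)⟦(1 : ℤ)⟧) E (t.ιHeart.obj Q)) :
    dimVecD R t E = dimVec Q - dimVec K := by
  obtain ⟨h1, h2, ⟨e₁⟩, ⟨e₂⟩⟩ := t.nonempty_iso_heartCohomology_of_hasTriangle H
  rw [dimVecD, finsum_eq_sum_of_support_subset (s := {-1, 0})]
  · rw [Finset.sum_pair (by simp), ← QuiverRelations.dimVec_of_iso e₁,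
      ← QuiverRelations.dimVec_of_iso e₂]
    simp
    abel
  · intro i hi
    by_contra h
    simp only [Finset.coe_insert, Finset.coe_singleton, Set.mem_insert_iff, Set.mem_singleton_iff,
      not_or] at h
    refine hi ?_
    have : IsZero (heartCohomology t R.Rep i E) := by
      rcases lt_or_gt_of_ne h.2 with h' | h'
      · exact t.isZero_heartCohomology_of_isGE E (-1) i h1 (by lia)
      · exact t.isZero_heartCohomology_of_isLE E 0 i h2 h'
    simp [(QuiverRelations.isZero_iff_dimVec _).1 this]

lemma dimVecD_of_iso {E E' : D} (e : E ≅ E') : dimVecD R t E = dimVecD R t E' := by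
  refine finsum_congr fun i => ?_
  rw [QuiverRelations.dimVec_of_iso (t.ιHeart.preimageIso (t.heartCohomologyIso R.Rep i E ≪≫
    (shiftFunctor D i).mapIso ((t.truncGELE i i).mapIso e) ≪≫
    (t.heartCohomologyIso R.Rep i E').symm))]

lemma dimVecD_heart_shift (M : R.Rep) (k : ℤ) :
    dimVecD R t ((t.ιHeart.obj M)⟦k⟧) = (k.negOnePow : ℤ) • dimVec M := by
  obtain ⟨i, rfl⟩ : ∃ i, k = -i := ⟨-k, by simp⟩
  have h1 := t.isLE_heart_shift M (-i)
  have h2 := t.isGE_heart_shift M (-i)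
  rw [neg_neg] at h1 h2
  obtain ⟨e⟩ := t.nonempty_iso_heartCohomology_shift M i
  rw [dimVecD, finsum_eq_single _ i, ← QuiverRelations.dimVec_of_iso e, Int.negOnePow_neg]
  intro j hj
  have : IsZero (heartCohomology t R.Rep j ((t.ιHeart.obj M)⟦-i⟧)) := by
    rcases lt_or_gt_of_ne hj with h' | h'
    · exact t.isZero_heartCohomology_of_isGE _ i j h2 h'
    · exact t.isZero_heartCohomology_of_isLE _ i j h1 h'
  simp [(QuiverRelations.isZero_iff_dimVec _).1 this]

lemma dimVecD_heart (M : R.Rep) : dimVecD R t (t.ιHeart.obj M) = dimVec M := by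
  refine (t.dimVecD_of_iso R ((shiftFunctorZero D ℤ).symm.app (t.ιHeart.obj M))).trans ?_
  simpa using t.dimVecD_heart_shift R M 0

/-- The dimension vector of the cone of a morphism between objects of the heart. -/
lemma dimVecD_cone {M N : R.Rep} {Z : D}
    (H : HasTriangle (t.ιHeart.obj M) (t.ιHeart.obj N) Z) :
    dimVecD R t Z = dimVec N - dimVec M := by
  obtain ⟨f, hf⟩ := t.hasTriangle_kernel_cokernel H
  rw [t.dimVecD_of_hasTriangle R hf, QuiverRelations.dimVec_sub_dimVec f]

end Rep

end CategoryTheory.Triangulated.TStructure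

end

/-! ### Harder–Narasimhan filtrations and the subcategories `P(I)`. -/

noncomputable section

open Triangulated

variable {D : Type u'} [Category.{v'} D] [Preadditive D] [HasZeroObject D] [HasShift D ℤ]
  [∀ n : ℤ, (shiftFunctor D n).Additive] [Pretriangulated D]

/-- `E` has a Harder–Narasimhan filtration whose phases are the elements of the given list, in
increasing order. -/
inductive HNList (P : ℝ → ObjectProperty D) : List ℝ → D → Prop
  | nil {E : D} : IsZero E → HNList P [] E
  | cons {φ : ℝ} {l : List ℝ} {X E F : D} : HNList P l X → (∀ ψ ∈ l, φ < ψ) → P φ F → ¬ IsZero F →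
      HasTriangle X E F → HNList P (φ :: l) E

namespace HNList

variable {P : ℝ → ObjectProperty D} {l l' : List ℝ} {X E Y : D}

lemma isZero_of_nil (h : HNList P [] E) : IsZero E := by
  cases h with
  | nil h => exact h

lemma of_iso (h : HNList P l E) (e : E ≅ Y) : HNList P l Y := by
  cases h with
  | nil h => exact .nil (h.of_iso e.symm)
  | cons h h1 h2 h3 h4 => exact .cons h h1 h2 h3 (h4.of_iso (Iso.refl _) e (Iso.refl _))

lemma single {φ : ℝ} (h : P φ E) (hE : ¬ IsZero E) : HNList P [φ] E :=
  .cons (.nil (isZero_zero D)) (by simp) h hE (.of_isZero₁ (isZero_zero D) (Iso.refl E))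

lemma pairwise (h : HNList P l E) : l.Pairwise (· < ·) := by
  induction h with
  | nil => exact .nil
  | cons _ h1 _ _ _ ih => exact .cons h1 ih

lemma not_isZero {φ : ℝ} (h : HNList P [φ] E) : ¬ IsZero E := by
  cases h with
  | cons h _ _ h3 h4 =>
    obtain ⟨e⟩ := h4.iso_of_isZero₁ h.isZero_of_nil
    exact fun hE => h3 (hE.of_iso e.symm)

lemma of_hasHNFiltration {n : ℕ} {φ : Fin n → ℝ} (h : HasHNFiltration P E n φ) :
    HNList P (List.ofFn φ).reverse E := by
  obtain ⟨hφ, X, F, h0, ⟨e⟩, H⟩ := h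
  refine HNList.of_iso ?_ e
  clear e
  induction n with
  | zero => simpa using HNList.nil h0
  | succ n ih =>
    rw [List.ofFn_succ', List.concat_eq_append, List.reverse_append,
      List.reverse_singleton, List.singleton_append]
    obtain ⟨h1, h2, h3⟩ := H (Fin.last n)
    refine .cons (ih (φ := fun i => φ i.castSucc) (fun i j hij => hφ (by simpa using hij))
      (fun i => X i.castSucc) (fun i => F i.castSucc) h0 (fun i => H i.castSucc)) ?_ h1 h2 h3
    intro ψ hψ
    simp only [List.mem_reverse, List.mem_ofFn] at hψ
    obtain ⟨i, rfl⟩ := hψ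
    exact hφ (Fin.castSucc_lt_last i)

lemma exists_hasHNFiltration (h : HNList P l E) :
    ∃ (n : ℕ) (φ : Fin n → ℝ), HasHNFiltration P E n φ ∧ ∀ x, x ∈ Set.range φ ↔ x ∈ l := by
  suffices ∃ (n : ℕ) (φ : Fin n → ℝ) (X : Fin (n + 1) → D) (F : Fin n → D), StrictAnti φ ∧
      (∀ x, x ∈ Set.range φ ↔ x ∈ l) ∧ IsZero (X 0) ∧ X (Fin.last n) = E ∧
      ∀ i : Fin n, P (φ i) (F i) ∧ ¬ IsZero (F i) ∧ HasTriangle (X i.castSucc) (X i.succ) (F i) by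
    obtain ⟨n, φ, X, F, h1, h2, h3, h4, h5⟩ := this
    exact ⟨n, φ, ⟨h1, X, F, h3, ⟨eqToIso h4⟩, h5⟩, h2⟩
  induction h with
  | @nil E h =>
    exact ⟨0, Fin.elim0, fun _ => E, Fin.elim0, fun i => i.elim0, by simp, h, rfl, fun i => i.elim0⟩
  | @cons φ₀ l X₀ E F₀ h h1 h2 h3 h4 ih =>
    obtain ⟨n, φ, X, F, g1, g2, g3, g4, g5⟩ := ih
    refine ⟨n + 1, Fin.snoc (α := fun _ => ℝ) φ φ₀, Fin.snoc (α := fun _ => D) X E,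
      Fin.snoc (α := fun _ => D) F F₀, ?_, ?_, ?_, ?_, ?_⟩
    · intro i j hij
      induction j using Fin.lastCases with
      | last =>
        induction i using Fin.lastCases with
        | last => exact (lt_irrefl _ hij).elim
        | cast i =>
          rw [Fin.snoc_last, Fin.snoc_castSucc]
          exact h1 _ ((g2 _).1 ⟨i, rfl⟩)
      | cast j =>
        induction i using Fin.lastCases with
        | last => exact (not_lt_of_ge (Fin.le_last _) hij).elim
        | cast i =>
          rw [Fin.snoc_castSucc, Fin.snoc_castSucc]
          exact g1 (by simpa using hij)
    · intro x
      rw [List.mem_cons, ← g2]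
      constructor
      · rintro ⟨i, rfl⟩
        induction i using Fin.lastCases with
        | last => exact .inl (by rw [Fin.snoc_last])
        | cast i => exact .inr ⟨i, by rw [Fin.snoc_castSucc]⟩
      · rintro (rfl | ⟨i, rfl⟩)
        · exact ⟨Fin.last n, by rw [Fin.snoc_last]⟩
        · exact ⟨i.castSucc, by rw [Fin.snoc_castSucc]⟩
    · have : (Fin.snoc (α := fun _ => D) X E : Fin (n + 2) → D) 0 = X 0 :=
        Fin.snoc_castSucc (α := fun _ => D) E X 0
      rwa [this]
    · exact Fin.snoc_last (α := fun _ => D) E X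
    · intro i
      induction i using Fin.lastCases with
      | last =>
        rw [Fin.snoc_last, Fin.snoc_last, Fin.succ_last, Fin.snoc_last, Fin.snoc_castSucc, g4]
        exact ⟨h2, h3, h4⟩
      | cast i =>
        rw [Fin.snoc_castSucc, Fin.snoc_castSucc, Fin.succ_castSucc, Fin.snoc_castSucc,
          Fin.snoc_castSucc]
        exact g5 i

lemma shift {k : ℤ} (hP : ∀ (φ : ℝ) (X : D), P φ X → P (φ + k) (X⟦k⟧)) (h : HNList P l X) :
    HNList P (l.map (· + (k : ℝ))) (X⟦k⟧) := by
  induction h with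
  | nil h => exact .nil (Functor.map_isZero _ h)
  | cons h h1 h2 h3 h4 ih =>
    refine .cons ih ?_ (hP _ _ h2) (fun h => h3 ?_) (h4.shift k)
    · simpa using h1
    · exact (TStructure.isZero_shift_iff _ k).1 h

section

variable [IsTriangulated D]

/-- The head of a list is the smallest phase, carried by the last quotient. Pulling the filtration
of `Y` back to `E` thus puts its phases in front of those of `X`. -/
lemma append (hX : HNList P l X) (hY : HNList P l' Y) (H : HasTriangle X E Y)
    (hl : ∀ a ∈ l', ∀ b ∈ l, a < b) : HNList P (l' ++ l) E := by
  induction hY generalizing E with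
  | nil h =>
    obtain ⟨e⟩ := H.iso_of_isZero₃ h
    exact hX.of_iso e
  | @cons φ l' Y' Y F h h1 h2 h3 h4 ih =>
    obtain ⟨E', H1, H2⟩ := H.exists_sub h4
    refine .cons (ih H1 fun a ha b hb => hl a (List.mem_cons_of_mem _ ha) b hb) ?_ h2 h3 H2
    intro ψ hψ
    rcases List.mem_append.1 hψ with hψ | hψ
    · exact h1 ψ hψ
    · exact hl φ List.mem_cons_self ψ hψ

lemma exists_of_append (h : HNList P (l' ++ l) E) :
    ∃ A B : D, HNList P l A ∧ HNList P l' B ∧ HasTriangle A E B := by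
  induction l' generalizing E with
  | nil => exact
    ⟨E, _, h, .nil (isZero_zero D), .of_isZero₃ (isZero_zero D) (Iso.refl E)⟩
  | cons φ l' ih =>
    rw [List.cons_append] at h
    cases h with
    | cons h h1 h2 h3 h4 =>
      obtain ⟨A, B, hA, hB, H⟩ := ih h
      obtain ⟨Q, H1, H2⟩ := H.exists_quotient h4
      exact ⟨A, Q, hA, .cons hB (fun ψ hψ => h1 ψ (List.mem_append_left _ hψ)) h2 h3 H2, H1⟩

lemma exists_split (h : HNList P l E) (c : ℝ) :
    ∃ (A B : D) (l₁ l₂ : List ℝ), HNList P l₁ A ∧ HNList P l₂ B ∧ HasTriangle A E B ∧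
      l = l₂ ++ l₁ ∧ (∀ φ ∈ l₁, c < φ) ∧ ∀ φ ∈ l₂, φ ≤ c := by
  obtain ⟨l₁, l₂, rfl, h1, h2⟩ : ∃ l₁ l₂ : List ℝ, l = l₂ ++ l₁ ∧ (∀ φ ∈ l₁, c < φ) ∧
      ∀ φ ∈ l₂, φ ≤ c := by
    have hl := h.pairwise
    clear h
    induction l with
    | nil => exact ⟨[], [], by simp⟩
    | cons φ l ih =>
      obtain ⟨h1, h2⟩ := List.pairwise_cons.1 hl
      by_cases hφ : c < φ
      · exact ⟨φ :: l, [], by simp, by simpa [hφ] using fun a ha => hφ.trans (h1 a ha), by simp⟩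
      · obtain ⟨l₁, l₂, rfl, h3, h4⟩ := ih h2
        exact ⟨l₁, φ :: l₂, by simp, h3, by simpa [not_lt.1 hφ] using h4⟩
  obtain ⟨A, B, hA, hB, H⟩ := h.exists_of_append
  exact ⟨A, B, l₁, l₂, hA, hB, H, rfl, h1, h2⟩

end

end HNList

namespace StabilityCondition

variable [IsTriangulated D] {V : Type u} [Fintype V] [Quiver.{v + 1} V] {R : QuiverRelations V}
  {t : TStructure D} [t.Heart R.Rep] (σ : StabilityCondition R t)
  {l l' : List ℝ} {X Y E : D} {I : Set ℝ}

lemma exists_hnList (E : D) : ∃ l, HNList σ.P l E := by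
  by_cases hE : IsZero E
  · exact ⟨[], .nil hE⟩
  · obtain ⟨n, φ, h⟩ := σ.exists_hn E hE
    exact ⟨_, .of_hasHNFiltration h⟩

lemma pInterval_iff : σ.PInterval I E ↔ ∃ l, HNList σ.P l E ∧ ∀ φ ∈ l, φ ∈ I := by
  constructor
  · rintro ⟨n, φ, h, hI⟩
    refine ⟨_, .of_hasHNFiltration h, fun x hx => ?_⟩
    simp only [List.mem_reverse, List.mem_ofFn] at hx
    obtain ⟨i, rfl⟩ := hx
    exact hI i
  · rintro ⟨l, h, hI⟩
    obtain ⟨n, φ, h1, h2⟩ := h.exists_hasHNFiltration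
    exact ⟨n, φ, h1, fun i => hI _ ((h2 _).1 ⟨i, rfl⟩)⟩

lemma mem_phases_iff {x : ℝ} : x ∈ σ.phases E ↔ ∃ l, HNList σ.P l E ∧ x ∈ l := by
  constructor
  · rintro ⟨n, φ, h, hx⟩
    exact ⟨_, .of_hasHNFiltration h, by simpa using hx⟩
  · rintro ⟨l, h, hx⟩
    obtain ⟨n, φ, h1, h2⟩ := h.exists_hasHNFiltration
    exact ⟨n, φ, h1, (h2 x).2 hx⟩

lemma pInterval_of_iso (h : σ.PInterval I X) (e : X ≅ Y) : σ.PInterval I Y := by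
  rw [pInterval_iff] at h ⊢
  obtain ⟨l, h, hI⟩ := h
  exact ⟨l, h.of_iso e, hI⟩

lemma pInterval_mono {J : Set ℝ} (h : σ.PInterval I X) (hIJ : I ⊆ J) : σ.PInterval J X := by
  obtain ⟨n, φ, h, hI⟩ := h
  exact ⟨n, φ, h, fun i => hIJ (hI i)⟩

lemma pInterval_of_isZero (h : IsZero X) : σ.PInterval I X :=
  σ.pInterval_iff.2 ⟨[], .nil h, by simp⟩

lemma pInterval_of_P {φ : ℝ} (h : σ.P φ X) (hφ : φ ∈ I) : σ.PInterval I X := by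
  by_cases hX : IsZero X
  · exact σ.pInterval_of_isZero hX
  · exact σ.pInterval_iff.2 ⟨[φ], .single h hX, by simpa using hφ⟩

lemma P_of_hnList_single {φ : ℝ} (h : HNList σ.P [φ] E) : σ.P φ E := by
  cases h with
  | cons h _ h2 _ h4 =>
    obtain ⟨e⟩ := h4.iso_of_isZero₁ h.isZero_of_nil
    exact σ.P_iso φ e.symm h2

lemma P_of_pInterval_singleton {φ : ℝ} (hE : σ.PInterval {φ} E) : σ.P φ E := by
  obtain ⟨l, h, hI⟩ := σ.pInterval_iff.1 hE
  rcases l with - | ⟨ψ, - | ⟨ψ', l⟩⟩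
  · exact σ.P_zero φ E h.isZero_of_nil
  · obtain rfl : ψ = φ := by simpa using hI
    exact σ.P_of_hnList_single h
  · have h1 : ψ = φ := hI ψ (by simp)
    have h2 : ψ' = φ := hI ψ' (by simp)
    have h3 := (List.pairwise_cons.1 h.pairwise).1 ψ' (by simp)
    exact (h3.ne (h1.trans h2.symm)).elim

lemma P_shift_int (φ : ℝ) (X : D) (k : ℤ) : σ.P (φ + k) (X⟦k⟧) ↔ σ.P φ X := by
  have iso (φ : ℝ) {X Y : D} (e : X ≅ Y) : σ.P φ X ↔ σ.P φ Y :=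
    ⟨σ.P_iso φ e, σ.P_iso φ e.symm⟩
  induction k using Int.induction_on with
  | zero =>
    rw [iso _ ((shiftFunctorZero D ℤ).app X)]
    simp
  | succ n ih =>
    rw [iso _ ((shiftFunctorAdd D (n : ℤ) 1).app X)]
    push_cast at ih ⊢
    rw [← add_assoc]
    exact (σ.P_shift _ _).trans ih
  | pred n ih =>
    refine Iff.trans ?_ ih
    rw [iso (φ + (-(n : ℤ) : ℤ)) ((shiftFunctorAdd' D (-(n : ℤ) - 1) 1 (-n) (by lia)).app X)]
    push_cast
    rw [show φ + -(n : ℝ) = φ + (-(n : ℝ) - 1) + 1 by ring]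
    exact (σ.P_shift _ _).symm

lemma hnList_shift (h : HNList σ.P l X) (k : ℤ) : HNList σ.P (l.map (· + (k : ℝ))) (X⟦k⟧) :=
  h.shift fun φ X hX => (σ.P_shift_int φ X k).2 hX

lemma pInterval_shift {J : Set ℝ} (h : σ.PInterval I X) (k : ℤ) (hJ : ∀ x ∈ I, x + k ∈ J) :
    σ.PInterval J (X⟦k⟧) := by
  obtain ⟨l, h, hI⟩ := σ.pInterval_iff.1 h
  refine σ.pInterval_iff.2 ⟨_, σ.hnList_shift h k, ?_⟩
  simpa using fun a ha => hJ a (hI a ha)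

lemma hnList_hom_eq_zero (hX : HNList σ.P l X) (hY : HNList σ.P l' Y)
    (H : ∀ a ∈ l, ∀ b ∈ l', b < a) (f : X ⟶ Y) : f = 0 := by
  induction hX with
  | nil h => exact h.eq_of_src _ _
  | @cons φ l X' X F h h1 h2 h3 h4 ih =>
    refine h4.hom_to_eq_zero (ih fun a ha b hb => H a (List.mem_cons_of_mem _ ha) b hb)
      (fun g => ?_) f
    clear ih f
    induction hY with
    | nil h => exact h.eq_of_tgt _ _
    | cons h h1 h2' h3 h4 ih =>
      exact h4.hom_from_eq_zero (ih fun a ha b hb => H a ha b (List.mem_cons_of_mem _ hb))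
        (fun g => σ.hom_eq_zero φ _ F _ g (H φ (by simp) _ (by simp)) h2 h2') g

lemma pInterval_hom_eq_zero {J : Set ℝ} (hX : σ.PInterval I X) (hY : σ.PInterval J Y)
    (H : ∀ a ∈ I, ∀ b ∈ J, b < a) (f : X ⟶ Y) : f = 0 := by
  obtain ⟨l, h, hI⟩ := σ.pInterval_iff.1 hX
  obtain ⟨l', h', hI'⟩ := σ.pInterval_iff.1 hY
  exact σ.hnList_hom_eq_zero h h' (fun a ha b hb => H a (hI a ha) b (hI' b hb)) f

/-- As `S` is a lower set, only the smallest phase matters. If it were in `S`, the last factor `F`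
would receive no nonzero map from `E`, nor from `X⟦1⟧` by phases, so the identity of `F` would
vanish. -/
lemma notMem_of_hom_to_eq_zero (hE : HNList σ.P l E) {S : Set ℝ} (hS : IsLowerSet S)
    (H : ∀ ψ ∈ S, ∀ (Y : D) (f : E ⟶ Y), σ.P ψ Y → f = 0) : ∀ φ ∈ l, φ ∉ S := by
  cases hE with
  | nil => simp
  | @cons φ l X E F h h1 h2 h3 h4 =>
    have hφ : φ ∉ S := fun hφ => by
      refine h3 ((IsZero.iff_id_eq_zero F).2 ?_)
      refine h4.rotate.hom_to_eq_zero (fun f => H φ hφ F f h2) (fun f => ?_) _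
      refine σ.hnList_hom_eq_zero (σ.hnList_shift h 1) (.single h2 h3) ?_ f
      simp only [List.mem_map, List.mem_singleton, forall_eq, Int.cast_one]
      rintro _ ⟨a, ha, rfl⟩
      linarith [h1 a ha]
    intro ψ hψ
    rcases List.mem_cons.1 hψ with rfl | hψ
    · exact hφ
    · exact fun hψS => hφ (hS (h1 ψ hψ).le hψS)

lemma notMem_of_hom_from_eq_zero (hE : HNList σ.P l E) {S : Set ℝ} (hS : IsUpperSet S)
    (H : ∀ ψ ∈ S, ∀ (Y : D) (f : Y ⟶ E), σ.P ψ Y → f = 0) : ∀ φ ∈ l, φ ∉ S := by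
  rcases List.eq_nil_or_concat l with rfl | ⟨l, φ, rfl⟩
  · simp
  · rw [List.concat_eq_append] at hE ⊢
    have hl := (List.pairwise_append.1 hE.pairwise).2.2
    obtain ⟨A, B, hA, hB, h4⟩ := hE.exists_of_append
    have hφ : φ ∉ S := fun hφ => by
      refine hA.not_isZero ((IsZero.iff_id_eq_zero A).2 ?_)
      refine h4.invRotate.hom_from_eq_zero (fun f => ?_)
        (fun f => H φ hφ A f (σ.P_of_hnList_single hA)) _
      refine σ.hnList_hom_eq_zero hA (σ.hnList_shift hB (-1)) ?_ f
      simp only [List.mem_map, List.mem_singleton, forall_eq]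
      rintro _ ⟨a, ha, rfl⟩
      have := hl a ha φ (by simp)
      push_cast
      linarith
    intro ψ hψ
    rcases List.mem_append.1 hψ with hψ | hψ
    · exact fun hψS => hφ (hS (hl ψ hψ φ (by simp)).le hψS)
    · rw [List.mem_singleton.1 hψ]
      exact hφ

/-- Orthogonality excludes phases below all of `I` and phases above all of `I`; convexity does the
rest. The conclusion concerns every filtration of `E`, so with `Y = 0` it replaces uniqueness of
Harder–Narasimhan filtrations. -/
lemma mem_of_hasTriangle [hI : I.OrdConnected] (hX : σ.PInterval I X) (hY : σ.PInterval I Y)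
    (H : HasTriangle X E Y) (hE : HNList σ.P l E) : ∀ φ ∈ l, φ ∈ I := by
  intro φ hφ
  have h1 : φ ∉ {ψ | ∀ x ∈ I, ψ < x} := by
    refine σ.notMem_of_hom_to_eq_zero hE (fun a b hba ha => by
      simp only [Set.mem_ofPred_eq] at ha ⊢
      exact fun x hx => hba.trans_lt (ha x hx))
      (fun ψ hψ Z f hZ => ?_) φ hφ
    have hZ' : σ.PInterval {ψ} Z := σ.pInterval_of_P hZ rfl
    refine H.hom_to_eq_zero (σ.pInterval_hom_eq_zero hX hZ' ?_)
      (σ.pInterval_hom_eq_zero hY hZ' ?_) f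
    all_goals
      rintro a ha _ rfl
      exact hψ a ha
  have h2 : φ ∉ {ψ | ∀ x ∈ I, x < ψ} := by
    refine σ.notMem_of_hom_from_eq_zero hE (fun a b hba ha => by
      simp only [Set.mem_ofPred_eq] at ha ⊢
      exact fun x hx => (ha x hx).trans_le hba)
      (fun ψ hψ Z f hZ => ?_) φ hφ
    have hZ' : σ.PInterval {ψ} Z := σ.pInterval_of_P hZ rfl
    refine H.hom_from_eq_zero (σ.pInterval_hom_eq_zero hZ' hX ?_)
      (σ.pInterval_hom_eq_zero hZ' hY ?_) f
    all_goals
      rintro _ rfl a ha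
      exact hψ a ha
  simp only [Set.mem_ofPred_eq, not_forall, not_lt] at h1 h2
  obtain ⟨x, hx, hx'⟩ := h1
  obtain ⟨y, hy, hy'⟩ := h2
  exact hI.out hx hy ⟨hx', hy'⟩

lemma pInterval_of_hasTriangle [I.OrdConnected] (hX : σ.PInterval I X) (hY : σ.PInterval I Y)
    (H : HasTriangle X E Y) : σ.PInterval I E := by
  obtain ⟨l, h⟩ := σ.exists_hnList E
  exact σ.pInterval_iff.2 ⟨l, h, σ.mem_of_hasTriangle hX hY H h⟩

lemma mem_of_pInterval [I.OrdConnected] (hX : σ.PInterval I X) (h : HNList σ.P l X) :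
    ∀ φ ∈ l, φ ∈ I :=
  σ.mem_of_hasTriangle hX (σ.pInterval_of_isZero (isZero_zero D))
    (.of_isZero₃ (isZero_zero D) (Iso.refl X)) h

lemma phases_subset_of_pInterval [I.OrdConnected] (hX : σ.PInterval I X) : σ.phases X ⊆ I := by
  intro x hx
  obtain ⟨l, h, hx⟩ := σ.mem_phases_iff.1 hx
  exact σ.mem_of_pInterval hX h x hx

end StabilityCondition

end

/-! ### Nearby stability conditions: torsion pair, heart and `P(0)`. -/

noncomputable section

open Triangulated

variable {D : Type u'} [Category.{v'} D] [Preadditive D] [HasZeroObject D] [HasShift D ℤ]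
  [∀ n : ℤ, (shiftFunctor D n).Additive] [Pretriangulated D] [IsTriangulated D]

namespace StabilityCondition

variable {V : Type u} [Fintype V] [Quiver.{v + 1} V] {R : QuiverRelations V}
  {t : TStructure D} [t.Heart R.Rep] (σ : StabilityCondition R t)
  {l : List ℝ} {X Y E : D} {I : Set ℝ}

lemma imZ_apply (n : V → ℤ) : σ.imZ n = (σ.Z n).im := rfl

lemma exists_im_charge {φ : ℝ} (hE : σ.P φ E) (h : ¬ IsZero E) :
    ∃ m : ℝ, 0 < m ∧ σ.imZ (dimVecD R t E) = m * Real.sin (Real.pi * φ) := by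
  obtain ⟨m, hm, h⟩ := σ.charge φ E hE h
  refine ⟨m, hm, ?_⟩
  rw [imZ_apply, h, ← Complex.ofReal_mul, Complex.im_ofReal_mul, Complex.exp_ofReal_mul_I_im]

variable {σ}

lemma pInterval_heart_of_mem_nearby (hσ : σ ∈ nearby R t) (M : R.Rep) :
    σ.PInterval (Set.Ioo (-1) 1) (t.ιHeart.obj M) :=
  hσ M

section

variable (ht : ∀ E : D, t.bounded E) (hσ : σ ∈ nearby R t)

include ht hσ

/-- An object of `D^{≤ 0}` is an iterated extension of shifts `M[-i]` with `i ≤ 0`, all of phases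
greater than `-1`. Phases at most `-1` are therefore right orthogonal to `D^{≤ 0}`; the general case
is a shift. -/
lemma isGE_of_P {φ : ℝ} (hY : σ.P φ Y) (n : ℤ) (hφ : φ ≤ -n) : t.IsGE Y n := by
  have key {φ : ℝ} {Y : D} (hY : σ.P φ Y) (hφ : φ ≤ -1) : t.IsGE Y 1 := by
    rw [t.isGE_iff_orthogonal 0 1 rfl]
    intro E f hE
    obtain ⟨a, b, ha, -⟩ := t.exists_bounds ht E
    refine t.induction_heart (A := R.Rep) (fun E => ∀ f : E ⟶ Y, f = 0)
      (fun E hE f => hE.eq_of_src _ _) a 0 (fun M i E _ hi e f => ?_)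
      (fun X E Y H h1 h2 => H.hom_to_eq_zero h1 h2) E ha hE f
    have h1 : σ.PInterval (Set.Ioi (-1)) E := by
      refine σ.pInterval_of_iso (σ.pInterval_shift (pInterval_heart_of_mem_nearby hσ M) (-i)
        fun x hx => ?_) e
      have : (i : ℝ) ≤ 0 := by exact_mod_cast hi
      push_cast
      have := hx.1
      simp only [Set.mem_Ioi]
      linarith
    refine σ.pInterval_hom_eq_zero h1 (σ.pInterval_of_P (I := {φ}) hY rfl) ?_ f
    rintro a ha _ rfl
    exact hφ.trans_lt ha
  have h1 := (σ.P_shift_int φ Y (n - 1)).2 hY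
  have := key h1 (by push_cast; linarith)
  exact t.isGE_of_shift Y n (n - 1) 1

lemma isLE_of_P {φ : ℝ} (hY : σ.P φ Y) (n : ℤ) (hφ : -n ≤ φ) : t.IsLE Y n := by
  have key {φ : ℝ} {Y : D} (hY : σ.P φ Y) (hφ : 1 ≤ φ) : t.IsLE Y (-1) := by
    rw [t.isLE_iff_orthogonal (-1) 0 rfl]
    intro E f hE
    obtain ⟨a, b, -, hb⟩ := t.exists_bounds ht E
    refine t.induction_heart (A := R.Rep) (fun E => ∀ f : Y ⟶ E, f = 0)
      (fun E hE f => hE.eq_of_tgt _ _) 0 b (fun M i E hi _ e f => ?_)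
      (fun X E Y H h1 h2 => H.hom_from_eq_zero h1 h2) E hE hb f
    have h1 : σ.PInterval (Set.Iio 1) E := by
      refine σ.pInterval_of_iso (σ.pInterval_shift (pInterval_heart_of_mem_nearby hσ M) (-i)
        fun x hx => ?_) e
      have : (0 : ℝ) ≤ i := by exact_mod_cast hi
      push_cast
      have := hx.2
      simp only [Set.mem_Iio]
      linarith
    refine σ.pInterval_hom_eq_zero (σ.pInterval_of_P (I := {φ}) hY rfl) h1 ?_ f
    rintro _ rfl a ha
    exact lt_of_lt_of_le ha hφ
  have h1 := (σ.P_shift_int φ Y (n + 1)).2 hY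
  have := key h1 (by push_cast; linarith)
  exact t.isLE_of_shift Y n (n + 1) (-1)

lemma isGE_of_hnList (h : HNList σ.P l E) (n : ℤ) (hl : ∀ φ ∈ l, φ ≤ -n) : t.IsGE E n := by
  induction h with
  | nil h => exact t.isGE_of_isZero h n
  | cons h h1 h2 h3 h4 ih =>
    exact h4.isGE₂ t n (ih fun φ hφ => hl φ (List.mem_cons_of_mem _ hφ))
      (isGE_of_P ht hσ h2 n (hl _ List.mem_cons_self))

lemma isLE_of_hnList (h : HNList σ.P l E) (n : ℤ) (hl : ∀ φ ∈ l, -n ≤ φ) : t.IsLE E n := by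
  induction h with
  | nil h => exact t.isLE_of_isZero h n
  | cons h h1 h2 h3 h4 ih =>
    exact h4.isLE₂ t n (ih fun φ hφ => hl φ (List.mem_cons_of_mem _ hφ))
      (isLE_of_P ht hσ h2 n (hl _ List.mem_cons_self))

/-- The decomposition of an object of the heart into a part with positive phases and a part with
nonpositive phases. -/
lemma exists_heart_split (M : R.Rep) : ∃ T F : R.Rep,
    σ.PInterval (Set.Ioo 0 1) (t.ιHeart.obj T) ∧ σ.PInterval (Set.Ioc (-1) 0) (t.ιHeart.obj F) ∧
      HasTriangle (t.ιHeart.obj T) (t.ιHeart.obj M) (t.ιHeart.obj F) := by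
  obtain ⟨l, h, hl⟩ := σ.pInterval_iff.1 (pInterval_heart_of_mem_nearby hσ M)
  obtain ⟨A, B, l₁, l₂, hA, hB, H, rfl, h1, h2⟩ := h.exists_split 0
  have h3 : t.IsLE A 0 := isLE_of_hnList ht hσ hA 0 (by simpa using fun φ hφ => (h1 φ hφ).le)
  have h4 : t.IsGE B 0 := isGE_of_hnList ht hσ hB 0 (by simpa using h2)
  -- Phases bound `A` and `B` on one side only; the missing bounds come from the triangle, since its
  -- middle term is in the heart.
  have h5 : t.IsGE A 0 := H.isGE₁ t 0 inferInstance (t.isGE_of_ge _ _ 0)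
  have h6 : t.IsLE B 0 := H.isLE₃ t 0 (t.isLE_of_le _ 0 _) inferInstance
  obtain ⟨T, ⟨eT⟩⟩ := t.exists_heart_iso R.Rep A h3 h5
  obtain ⟨F, ⟨eF⟩⟩ := t.exists_heart_iso R.Rep B h6 h4
  refine ⟨T, F, σ.pInterval_of_iso (σ.pInterval_iff.2 ⟨l₁, hA, fun φ hφ => ?_⟩) eT.symm,
    σ.pInterval_of_iso (σ.pInterval_iff.2 ⟨l₂, hB, fun φ hφ => ?_⟩) eF.symm,
    H.of_iso eT.symm (Iso.refl _) eF.symm⟩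
  · exact ⟨h1 φ hφ, (hl φ (List.mem_append_right _ hφ)).2⟩
  · exact ⟨(hl φ (List.mem_append_left _ hφ)).1, h2 φ hφ⟩

/-- The semistable factors need not lie in `𝒜`. Removing the factor of smallest phase leaves a
subobject `X` that does, and the factor is the cone of a morphism of `𝒜`; this gives additivity of
`Im Z` at each step. -/
lemma imZ_nonneg_of_hnList (M : R.Rep) (h : HNList σ.P l (t.ιHeart.obj M))
    (hl : ∀ φ ∈ l, φ ∈ Set.Ioo (0 : ℝ) 1) :
    0 ≤ σ.imZ (dimVec M) ∧ (l ≠ [] → 0 < σ.imZ (dimVec M)) := by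
  induction l generalizing M with
  | nil =>
    have := (t.isZero_heart_iff M).1 h.isZero_of_nil
    simp [(QuiverRelations.isZero_iff_dimVec M).1 this]
  | cons φ l ih =>
    suffices 0 < σ.imZ (dimVec M) from ⟨this.le, fun _ => this⟩
    cases h with
    | @cons _ _ X _ F h h1 h2 h3 h4 =>
      have hφ := hl φ List.mem_cons_self
      have hl' : ∀ ψ ∈ l, ψ ∈ Set.Ioo (0 : ℝ) 1 := fun ψ hψ => hl ψ (List.mem_cons_of_mem _ hψ)
      have h5 : t.IsLE X 0 := isLE_of_hnList ht hσ h 0 (by simpa using fun ψ hψ => (hl' ψ hψ).1.le)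
      have h6 : t.IsGE F (-1) := isGE_of_P ht hσ h2 (-1) (by simpa using hφ.2.le)
      have h7 : t.IsGE X 0 := h4.isGE₁ t 0 inferInstance h6
      obtain ⟨N, ⟨e⟩⟩ := t.exists_heart_iso R.Rep X h5 h7
      have H := t.dimVecD_cone R (h4.of_iso e.symm (Iso.refl _) (Iso.refl _))
      obtain ⟨m, hm, hm'⟩ := σ.exists_im_charge h2 h3
      rw [H, map_sub] at hm'
      have h8 := (ih N (h.of_iso e.symm) hl').1
      have h9 : 0 < Real.sin (Real.pi * φ) := by
        refine Real.sin_pos_of_pos_of_lt_pi (mul_pos Real.pi_pos hφ.1) ?_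
        nlinarith [Real.pi_pos, hφ.2]
      nlinarith [mul_pos hm h9]

lemma imZ_pos {M : R.Rep} (h : σ.PInterval (Set.Ioo 0 1) (t.ιHeart.obj M)) (hM : ¬ IsZero M) :
    0 < σ.imZ (dimVec M) := by
  obtain ⟨l, h, hl⟩ := σ.pInterval_iff.1 h
  refine (imZ_nonneg_of_hnList ht hσ M h hl).2 ?_
  rintro rfl
  exact hM ((t.isZero_heart_iff M).1 h.isZero_of_nil)

/-- Here the factor `A` of largest phase is removed. The remaining quotient is in `𝒜`, and the cone
of `M ⟶ B` is `A⟦1⟧`, of phase `φ + 1 ∈ (0, 1]`, where the sine vanishes only for `φ = 0`. -/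
lemma imZ_nonpos_of_hnList (M : R.Rep) (h : HNList σ.P l (t.ιHeart.obj M))
    (hl : ∀ φ ∈ l, φ ∈ Set.Ioc (-1 : ℝ) 0) :
    σ.imZ (dimVec M) ≤ 0 ∧ (σ.imZ (dimVec M) = 0 → ∀ φ ∈ l, φ = 0) := by
  induction l using List.reverseRecOn generalizing M with
  | nil =>
    have := (t.isZero_heart_iff M).1 h.isZero_of_nil
    simp [(QuiverRelations.isZero_iff_dimVec M).1 this]
  | append_singleton l φ ih =>
    obtain ⟨A, B, hA, hB, H⟩ := h.exists_of_append
    have hφ := hl φ (by simp)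
    have hl' : ∀ ψ ∈ l, ψ ∈ Set.Ioc (-1 : ℝ) 0 := fun ψ hψ => hl ψ (by simp [hψ])
    have hA' := σ.P_of_hnList_single hA
    have h1 : t.IsGE B 0 := isGE_of_hnList ht hσ hB 0 (by simpa using fun ψ hψ => (hl' ψ hψ).2)
    have h2 : t.IsLE A 1 := isLE_of_P ht hσ hA' 1 (by simpa using hφ.1.le)
    have h3 : t.IsLE B 0 := H.isLE₃ t 0 h2 inferInstance
    obtain ⟨N, ⟨e⟩⟩ := t.exists_heart_iso R.Rep B h3 h1
    have H' := t.dimVecD_cone R (H.rotate.of_iso (Iso.refl _) e.symm (Iso.refl _))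
    obtain ⟨m, hm, hm'⟩ := σ.exists_im_charge ((σ.P_shift φ A).2 hA')
      (fun hz => hA.not_isZero ((TStructure.isZero_shift_iff A 1).1 hz))
    rw [H', map_sub] at hm'
    have h4 := ih N (hB.of_iso e.symm) hl'
    have h5 : 0 ≤ Real.sin (Real.pi * (φ + 1)) := by
      refine Real.sin_nonneg_of_nonneg_of_le_pi
        (mul_nonneg Real.pi_pos.le (by linarith [hφ.1])) ?_
      nlinarith [Real.pi_pos, hφ.2]
    have h6 := mul_nonneg hm.le h5
    refine ⟨by linarith [h4.1], fun h0 => ?_⟩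
    have h7 : σ.imZ (dimVec N) = 0 := by linarith [h4.1]
    have h8 : m * Real.sin (Real.pi * (φ + 1)) = 0 := by linarith
    have h9 : φ = 0 := by
      by_contra hne
      have hlt : φ < 0 := lt_of_le_of_ne hφ.2 hne
      have : 0 < Real.sin (Real.pi * (φ + 1)) := by
        refine Real.sin_pos_of_pos_of_lt_pi (mul_pos Real.pi_pos (by linarith [hφ.1])) ?_
        nlinarith [Real.pi_pos]
      exact (mul_pos hm this).ne' h8
    intro ψ hψ
    rcases List.mem_append.1 hψ with hψ | hψ
    · exact h4.2 h7 ψ hψ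
    · rw [List.mem_singleton.1 hψ, h9]

lemma imZ_nonpos {M : R.Rep} (h : σ.PInterval (Set.Ioc (-1) 0) (t.ιHeart.obj M)) :
    σ.imZ (dimVec M) ≤ 0 := by
  obtain ⟨l, h, hl⟩ := σ.pInterval_iff.1 h
  exact (imZ_nonpos_of_hnList ht hσ M h hl).1

lemma P_zero_of_imZ_eq_zero {M : R.Rep} (h : σ.PInterval (Set.Ioc (-1) 0) (t.ιHeart.obj M))
    (h0 : σ.imZ (dimVec M) = 0) : σ.P 0 (t.ιHeart.obj M) := by
  obtain ⟨l, h, hl⟩ := σ.pInterval_iff.1 h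
  exact σ.P_of_pInterval_singleton
    (σ.pInterval_iff.2 ⟨l, h, (imZ_nonpos_of_hnList ht hσ M h hl).2 h0⟩)

omit ht hσ in
lemma heart_hom_eq_zero {M N : R.Rep} {I J : Set ℝ} (hM : σ.PInterval I (t.ιHeart.obj M))
    (hN : σ.PInterval J (t.ιHeart.obj N)) (h : ∀ a ∈ I, ∀ b ∈ J, b < a) (f : M ⟶ N) : f = 0 :=
  t.ιHeart.map_injective ((σ.pInterval_hom_eq_zero hM hN h _).trans (t.ιHeart.map_zero M N).symm)

/-- A quotient without a map to an object of nonpositive phases has positive phases. -/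
lemma pInterval_of_hom_eq_zero (B : R.Rep)
    (h : ∀ F : R.Rep, σ.PInterval (Set.Ioc (-1) 0) (t.ιHeart.obj F) → ∀ g : B ⟶ F, g = 0) :
    σ.PInterval (Set.Ioo 0 1) (t.ιHeart.obj B) := by
  obtain ⟨T, F, hT, hF, H⟩ := exists_heart_split ht hσ B
  obtain ⟨f, g, w, hS⟩ := t.exists_shortExact_of_hasTriangle H
  have := hS.epi_g
  have hg : g = 0 := h F hF g
  have hF0 : IsZero F := by
    dsimp at this
    rw [IsZero.iff_id_eq_zero, ← cancel_epi g, hg, zero_comp, zero_comp]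
  obtain ⟨e⟩ := H.iso_of_isZero₃ (Functor.map_isZero _ hF0)
  exact σ.pInterval_of_iso hT e

lemma pInterval_of_hom_eq_zero' (B : R.Rep)
    (h : ∀ T : R.Rep, σ.PInterval (Set.Ioo 0 1) (t.ιHeart.obj T) → ∀ f : T ⟶ B, f = 0) :
    σ.PInterval (Set.Ioc (-1) 0) (t.ιHeart.obj B) := by
  obtain ⟨T, F, hT, hF, H⟩ := exists_heart_split ht hσ B
  obtain ⟨f, g, w, hS⟩ := t.exists_shortExact_of_hasTriangle H
  have := hS.mono_f
  have hf : f = 0 := h T hT f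
  have hT0 : IsZero T := by
    dsimp at this
    rw [IsZero.iff_id_eq_zero, ← cancel_mono f, hf, comp_zero, comp_zero]
  obtain ⟨e⟩ := H.iso_of_isZero₁ (Functor.map_isZero _ hT0)
  exact σ.pInterval_of_iso hF e.symm

/-- For `M ∈ 𝒯(θ)` the quotient `F` of its splitting has `θ(F) ≤ 0`, so it is zero. Conversely,
quotients of `M` inherit the absence of maps to objects of nonpositive phases. -/
lemma torsionPart_iff (M : R.Rep) :
    torsionPart R σ.imZ M ↔ σ.PInterval (Set.Ioo 0 1) (t.ιHeart.obj M) := by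
  constructor
  · intro h
    obtain ⟨T, F, hT, hF, H⟩ := exists_heart_split ht hσ M
    obtain ⟨f, g, w, hS⟩ := t.exists_shortExact_of_hasTriangle H
    have hF0 : IsZero F := by
      by_contra hF0
      exact (imZ_nonpos ht hσ hF).not_gt (h F g hS.epi_g hF0)
    obtain ⟨e⟩ := H.iso_of_isZero₃ (Functor.map_isZero _ hF0)
    exact σ.pInterval_of_iso hT e
  · intro h L p hp hL
    refine imZ_pos ht hσ (pInterval_of_hom_eq_zero ht hσ L fun F hF g => ?_) hL
    rw [← cancel_epi p, comp_zero]
    exact heart_hom_eq_zero h hF (fun a ha b hb => hb.2.trans_lt ha.1) _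

lemma torsionFreePart_iff (M : R.Rep) :
    torsionFreePart R σ.imZ M ↔ σ.PInterval (Set.Ioc (-1) 0) (t.ιHeart.obj M) := by
  constructor
  · intro h
    obtain ⟨T, F, hT, hF, H⟩ := exists_heart_split ht hσ M
    obtain ⟨f, g, w, hS⟩ := t.exists_shortExact_of_hasTriangle H
    have hT0 : IsZero T := by
      by_contra hT0
      exact (h T f hS.mono_f).not_gt (imZ_pos ht hσ hT hT0)
    obtain ⟨e⟩ := H.iso_of_isZero₁ (Functor.map_isZero _ hT0)
    exact σ.pInterval_of_iso hF e.symm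
  · intro h L i hi
    refine imZ_nonpos ht hσ (pInterval_of_hom_eq_zero' ht hσ L fun T hT f => ?_)
    rw [← cancel_mono i, zero_comp]
    exact heart_hom_eq_zero hT h (fun a ha b hb => hb.2.trans_lt ha.1) _

theorem isTorsionPair_imZ : IsTorsionPair (torsionPart R σ.imZ) (torsionFreePart R σ.imZ) := by
  constructor
  · intro X Y f hX hY
    rw [torsionPart_iff ht hσ] at hX
    rw [torsionFreePart_iff ht hσ] at hY
    exact heart_hom_eq_zero hX hY (fun a ha b hb => hb.2.trans_lt ha.1) f
  · intro E
    obtain ⟨T, F, hT, hF, H⟩ := exists_heart_split ht hσ E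
    obtain ⟨f, g, w, hS⟩ := t.exists_shortExact_of_hasTriangle H
    exact ⟨_, hS, (torsionPart_iff ht hσ T).2 hT, rfl, (torsionFreePart_iff ht hσ F).2 hF⟩

theorem P_zero_iff (E : D) :
    σ.P 0 E ↔ ∃ M : R.Rep, IsSemistable R σ.imZ M ∧ Nonempty (t.ιHeart.obj M ≅ E) := by
  constructor
  · intro h
    obtain ⟨M, ⟨e⟩⟩ := t.exists_heart_iso R.Rep E (isLE_of_P ht hσ h 0 (by simp))
      (isGE_of_P ht hσ h 0 (by simp))
    have hM : σ.P 0 (t.ιHeart.obj M) := σ.P_iso 0 e.symm h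
    refine ⟨M, ⟨?_, (torsionFreePart_iff ht hσ M).2 (σ.pInterval_of_P hM (by simp))⟩, ⟨e⟩⟩
    by_cases hz : IsZero M
    · rw [(QuiverRelations.isZero_iff_dimVec M).1 hz, map_zero]
    · obtain ⟨m, -, hm⟩ := σ.exists_im_charge hM (fun h => hz ((t.isZero_heart_iff M).1 h))
      rw [t.dimVecD_heart R M] at hm
      simpa using hm
  · rintro ⟨M, ⟨h0, h⟩, ⟨e⟩⟩
    exact σ.P_iso 0 e (P_zero_of_imZ_eq_zero ht hσ ((torsionFreePart_iff ht hσ M).1 h) h0)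

theorem heart_eq_tiltedHeart : σ.heart = tiltedHeart R t σ.imZ := by
  ext E
  constructor
  · intro h
    obtain ⟨l, hl, hI⟩ := σ.pInterval_iff.1 h
    have h1 : t.IsGE E (-1) := isGE_of_hnList ht hσ hl (-1) (by simpa using fun φ hφ => (hI φ hφ).2)
    have h2 : t.IsLE E 0 := isLE_of_hnList ht hσ hl 0
      (by simpa using fun φ hφ => (hI φ hφ).1.le)
    have H := t.hasTriangle_heartCohomology (A := R.Rep) E h1 h2
    set K := heartCohomology t R.Rep (-1) E
    set Q := heartCohomology t R.Rep 0 E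
    refine ⟨(torsionFreePart_iff ht hσ K).2 ?_, (torsionPart_iff ht hσ Q).2 ?_, fun i h3 h4 => ?_⟩
    · refine pInterval_of_hom_eq_zero' ht hσ K fun T hT f => ?_
      have hT' : σ.PInterval (Set.Ioi 1) ((t.ιHeart.obj T)⟦(1 : ℤ)⟧) :=
        σ.pInterval_shift hT 1 fun x hx => by simpa using hx.1
      -- In the triangle `Q[-1] ⟶ K[1] ⟶ E`, maps from `T[1]` to `Q[-1]` vanish by the t-structure,
      -- and maps from `T[1]` to `E` because phases above `1` meet phases at most `1`.
      have h5 : (t.ιHeart.map f)⟦(1 : ℤ)⟧' = 0 := by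
        refine H.invRotate.hom_from_eq_zero (fun g => ?_) (fun g => ?_) _
        · have := t.isLE_heart_shift T 1
          have := t.isGE_heart_shift Q (-1)
          exact t.zero g (-1) (- -1)
        · exact σ.pInterval_hom_eq_zero hT' h (fun a ha b hb => lt_of_le_of_lt hb.2 ha) g
      exact t.ιHeart.map_injective <| (shiftFunctor D (1 : ℤ)).map_injective (by simp [h5])
    · refine pInterval_of_hom_eq_zero ht hσ Q fun F hF g => ?_
      -- Dually, in `E ⟶ Q ⟶ K[2]`, maps to `F` vanish from `E` by phases and from `K[2]` by the
      -- t-structure.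
      have h5 : t.ιHeart.map g = 0 := by
        refine H.rotate.hom_to_eq_zero (fun g => ?_) (fun g => ?_) _
        · exact σ.pInterval_hom_eq_zero h hF (fun a ha b hb => lt_of_le_of_lt hb.2 ha.1) g
        · have := t.isLE_heart_shift K 1
          have := t.isLE_shift ((t.ιHeart.obj K)⟦(1 : ℤ)⟧) (-1) 1 (-2)
          exact t.zero g (-2) 0
      exact t.ιHeart.map_injective (by simp [h5])
    · rcases lt_or_gt_of_ne h4 with h' | h'
      · exact t.isZero_heartCohomology_of_isGE E (-1) i h1 (by lia)
      · exact t.isZero_heartCohomology_of_isLE E 0 i h2 h'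
  · rintro ⟨hK, hQ, h0⟩
    have h1 : t.IsGE E (-1) := t.isGE_of_isZero_heartCohomology (A := R.Rep) ht E (-1)
      fun i hi => h0 i (by lia) (by lia)
    have h2 : t.IsLE E 0 := t.isLE_of_isZero_heartCohomology (A := R.Rep) ht E 0
      fun i hi => h0 i (by lia) (by lia)
    have H := t.hasTriangle_heartCohomology (A := R.Rep) E h1 h2
    rw [torsionFreePart_iff ht hσ] at hK
    rw [torsionPart_iff ht hσ] at hQ
    refine σ.pInterval_of_hasTriangle (σ.pInterval_shift hK 1 fun x hx => ?_)
      (σ.pInterval_mono hQ Set.Ioo_subset_Ioc_self) H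
    have h3 := hx.1
    have h4 := hx.2
    simp only [Int.cast_one, Set.mem_Ioc]
    constructor <;> linarith

end

end StabilityCondition

end

/-! ### Slope stability and a stability condition in every fibre. -/

noncomputable section

open Triangulated QuiverRelations

section Semistable

variable {V : Type u} [Quiver.{v + 1} V] {R : QuiverRelations V}

/-- A subobject of the middle term is an extension of its image in `S.X₃` by its intersection with
`S.X₁`. -/
lemma isSemistable_of_shortExact (η : (V → ℤ) →+ ℝ) {S : ShortComplex R.Rep} (hS : S.ShortExact)
    (h₁ : IsSemistable R η S.X₁) (h₃ : IsSemistable R η S.X₃) : IsSemistable R η S.X₂ := by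
  refine ⟨by rw [dimVec_shortExact hS, map_add, h₁.1, h₃.1, add_zero], fun L i hi => ?_⟩
  have := hS.mono_f
  have h1 := dimVec_cokernel (kernel.ι (i ≫ S.g))
  have h2 := h₃.2 _ ((Abelian.coimageIsoImage (i ≫ S.g)).hom ≫ Abelian.image.ι (i ≫ S.g))
    inferInstance
  let k : kernel (i ≫ S.g) ⟶ S.X₁ := hS.exact.lift (kernel.ι (i ≫ S.g) ≫ i) (by simp)
  have hk : k ≫ S.f = kernel.ι (i ≫ S.g) ≫ i := hS.exact.lift_f _ _
  have : Mono (k ≫ S.f) := hk ▸ inferInstance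
  have h3 := h₁.2 _ k (mono_of_mono k S.f)
  rw [h1, map_add]
  exact add_nonpos h3 h2

lemma isSemistable_biprod (η : (V → ℤ) →+ ℝ) {M N : R.Rep} (hM : IsSemistable R η M)
    (hN : IsSemistable R η N) : IsSemistable R η (M ⊞ N) :=
  isSemistable_of_shortExact η
    (ShortComplex.Splitting.ofHasBinaryBiproduct M N).shortExact hM hN

end Semistable

section Slope

variable {V : Type u} [Fintype V]

/-- The weight `θ - s δ`, where `δ` is the total dimension. -/
def shiftedWeight (θ : (V → ℤ) →+ ℝ) (s : ℝ) : (V → ℤ) →+ ℝ where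
  toFun n := θ n - s * ∑ i, (n i : ℝ)
  map_zero' := by simp
  map_add' m n := by
    simp only [map_add, Pi.add_apply, Int.cast_add, Finset.sum_add_distrib]
    ring

/-- The central charge `δ + iθ`, where `δ` is the total dimension. -/
def chargeOfWeight (θ : (V → ℤ) →+ ℝ) : (V → ℤ) →+ ℂ where
  toFun n := ⟨∑ i, (n i : ℝ), θ n⟩
  map_zero' := by simp [Complex.ext_iff]
  map_add' m n := by simp [Complex.ext_iff, Finset.sum_add_distrib]

variable [Quiver.{v + 1} V] {R : QuiverRelations V} (θ : (V → ℤ) →+ ℝ)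

lemma shiftedWeight_dimVec (s : ℝ) (M : R.Rep) :
    shiftedWeight θ s (dimVec M) = θ (dimVec M) - s * totalDim M := by
  simp [shiftedWeight, totalDim]

/-- A nonzero image would have slope at least `s` as a quotient of `M` and at most `s'` as a
subobject of `N`. -/
lemma semistable_hom_eq_zero {s s' : ℝ} (hs : s' < s) {M N : R.Rep}
    (hM : IsSemistable R (shiftedWeight θ s) M) (hN : IsSemistable R (shiftedWeight θ s') N)
    (f : M ⟶ N) : f = 0 := by
  have h1 := dimVec_cokernel (kernel.ι f)
  have h2 := hM.2 _ (kernel.ι f) inferInstance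
  have h3 := hN.2 _ ((Abelian.coimageIsoImage f).hom ≫ Abelian.image.ι f) inferInstance
  have h4 := hM.1
  rw [h1, map_add] at h4
  change shiftedWeight θ s' (dimVec (cokernel (kernel.ι f))) ≤ 0 at h3
  rw [shiftedWeight_dimVec] at h2 h3
  rw [shiftedWeight_dimVec, shiftedWeight_dimVec] at h4
  have h5 : IsZero (cokernel (kernel.ι f)) := by
    by_contra h
    have h6 : (0 : ℝ) < totalDim (cokernel (kernel.ι f)) := by exact_mod_cast totalDim_pos h
    nlinarith
  rw [← Abelian.coimage.fac f]
  exact (congrArg (· ≫ _) (h5.eq_of_tgt _ 0)).trans zero_comp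

/-- A maximal destabilizing subobject. -/
lemma exists_max_slope {M : R.Rep} (hM : ¬ IsZero M) :
    ∃ (F : R.Rep) (i : F ⟶ M) (s : ℝ), Mono i ∧ ¬ IsZero F ∧ shiftedWeight θ s (dimVec F) = 0 ∧
      ∀ (L : R.Rep) (j : L ⟶ M), Mono j → ¬ IsZero L → shiftedWeight θ s (dimVec L) ≤ 0 ∧
        (shiftedWeight θ s (dimVec L) = 0 → totalDim L ≤ totalDim F) := by
  classical
  let S : Set (V → ℤ) := {n | ∃ (L : R.Rep) (j : L ⟶ M), Mono j ∧ ¬ IsZero L ∧ dimVec L = n}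
  have hfin : S.Finite := by
    refine (Set.finite_Icc (0 : V → ℤ) (dimVec M)).subset ?_
    rintro _ ⟨L, j, hj, -, rfl⟩
    exact ⟨dimVec_nonneg L, dimVec_le_of_mono j⟩
  have hne : S.Nonempty := ⟨_, M, 𝟙 M, inferInstance, hM, rfl⟩
  -- Largest slope first, then largest dimension; the tie-break makes all slopes of the quotient
  -- strictly smaller.
  let g : (V → ℤ) → ℝ ×ₗ ℤ := fun n => toLex (θ n / ∑ i, (n i : ℝ), ∑ i, n i)
  obtain ⟨_, ⟨F, i, hi, hF, rfl⟩, hmax⟩ := Set.exists_max_image S g hfin hne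
  have hd {L : R.Rep} (hL : ¬ IsZero L) : (0 : ℝ) < totalDim L := by exact_mod_cast totalDim_pos hL
  have hg (L : R.Rep) : g (dimVec L) = toLex (θ (dimVec L) / totalDim L, totalDim L) := by
    simp [g, totalDim]
  refine ⟨F, i, θ (dimVec F) / totalDim F, hi, hF, ?_, fun L j hj hL => ?_⟩
  · rw [shiftedWeight_dimVec, div_mul_cancel₀ _ (hd hF).ne', sub_self]
  · have h1 := hmax _ ⟨L, j, hj, hL, rfl⟩
    rw [hg, hg, Prod.Lex.toLex_le_toLex] at h1
    rw [shiftedWeight_dimVec]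
    rcases h1 with h1 | ⟨h1, h2⟩
    · dsimp at h1
      rw [div_lt_iff₀ (hd hL)] at h1
      exact ⟨by linarith, fun h => by linarith⟩
    · dsimp at h1 h2
      rw [div_eq_iff (hd hL).ne'] at h1
      exact ⟨by linarith, fun _ => h2⟩

end Slope

variable {D : Type u'} [Category.{v'} D] [Preadditive D] [HasZeroObject D] [HasShift D ℤ]
  [∀ n : ℤ, (shiftFunctor D n).Additive] [Pretriangulated D]

variable {V : Type u} [Fintype V] [Quiver.{v + 1} V] (R : QuiverRelations V)
  (t : TStructure D) [t.Heart R.Rep] (θ : (V → ℤ) →+ ℝ)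

/-- The slicing of `D` given by the shifts of the slope-semistable representations. -/
def slopeSlicing (φ : ℝ) : ObjectProperty D := fun E =>
  IsZero E ∨ ∃ (k : ℤ) (s : ℝ) (M : R.Rep), IsSemistable R (shiftedWeight θ s) M ∧
    φ = k + Real.arctan s / Real.pi ∧ Nonempty ((t.ιHeart.obj M)⟦k⟧ ≅ E)

namespace slopeSlicing

variable {R t θ} {φ ψ : ℝ} {X Y E : D}

lemma of_iso (e : X ≅ Y) (h : slopeSlicing R t θ φ X) : slopeSlicing R t θ φ Y := by
  rcases h with h | ⟨k, s, M, h1, h2, ⟨e'⟩⟩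
  · exact .inl (h.of_iso e.symm)
  · exact .inr ⟨k, s, M, h1, h2, ⟨e' ≪≫ e⟩⟩

lemma shift (k : ℤ) (h : slopeSlicing R t θ φ X) : slopeSlicing R t θ (φ + k) (X⟦k⟧) := by
  rcases h with h | ⟨k', s, M, h1, h2, ⟨e⟩⟩
  · exact .inl (Functor.map_isZero _ h)
  · refine .inr ⟨k' + k, s, M, h1, ?_,
      ⟨(shiftFunctorAdd D k' k).app _ ≪≫ (shiftFunctor D k).mapIso e⟩⟩
    rw [h2]
    push_cast
    ring

lemma arctan_div_pi_mem (s : ℝ) : Real.arctan s / Real.pi ∈ Set.Ioo (-(1 / 2) : ℝ) (1 / 2) := by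
  have h1 := Real.arctan_lt_pi_div_two s
  have h2 := Real.neg_pi_div_two_lt_arctan s
  constructor
  · rw [lt_div_iff₀ Real.pi_pos]
    linarith
  · rw [div_lt_iff₀ Real.pi_pos]
    linarith

/-- The arctangent terms lie in `(-1/2, 1/2)`, so a phase determines the shift and the slope. -/
lemma le_of_add_arctan_le {k k' : ℤ} {s s' : ℝ}
    (h : k + Real.arctan s / Real.pi ≤ k' + Real.arctan s' / Real.pi) : k ≤ k' := by
  have h1 := arctan_div_pi_mem s
  have h2 := arctan_div_pi_mem s'
  have : (k : ℝ) < k' + 1 := by linarith [h1.1, h2.2]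
  exact Int.lt_add_one_iff.1 (by exact_mod_cast this)

lemma arctan_div_pi_lt {s s' : ℝ} (h : s < s') :
    Real.arctan s / Real.pi < Real.arctan s' / Real.pi :=
  div_lt_div_of_pos_right (Real.arctan_strictMono h) Real.pi_pos

lemma lt_of_arctan_div_pi_lt {s s' : ℝ}
    (h : Real.arctan s / Real.pi < Real.arctan s' / Real.pi) : s < s' :=
  Real.arctan_strictMono.lt_iff_lt.1 ((div_lt_div_iff_of_pos_right Real.pi_pos).1 h)

lemma hom_eq_zero (hφ : ψ < φ) (hX : slopeSlicing R t θ φ X) (hY : slopeSlicing R t θ ψ Y)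
    (f : X ⟶ Y) : f = 0 := by
  rcases hX with hX | ⟨k, s, M, h1, h2, ⟨e⟩⟩
  · exact hX.eq_of_src _ _
  rcases hY with hY | ⟨k', s', M', h1', h2', ⟨e'⟩⟩
  · exact hY.eq_of_tgt _ _
  rw [← cancel_epi e.hom, ← cancel_mono e'.inv, comp_zero, zero_comp]
  generalize (e.hom ≫ f) ≫ e'.inv = g
  rw [h2, h2'] at hφ
  rcases (le_of_add_arctan_le hφ.le).lt_or_eq with hk | rfl
  · have := t.isLE_heart_shift M k
    have := t.isGE_heart_shift M' k'
    exact t.zero g (-k) (-k')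
  · obtain ⟨g, rfl⟩ := (shiftFunctor D k').map_surjective g
    obtain ⟨g, rfl⟩ := t.ιHeart.map_surjective g
    rw [semistable_hom_eq_zero θ (lt_of_arctan_div_pi_lt (by linarith)) h1 h1' g]
    simp

lemma of_semistable {M : R.Rep} {s : ℝ} (h : IsSemistable R (shiftedWeight θ s) M) :
    slopeSlicing R t θ (Real.arctan s / Real.pi) (t.ιHeart.obj M) :=
  .inr ⟨0, s, M, h, by simp, ⟨(shiftFunctorZero D ℤ).app _⟩⟩

lemma biprod (hX : slopeSlicing R t θ φ X) (hY : slopeSlicing R t θ φ Y) :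
    slopeSlicing R t θ φ (X ⊞ Y) := by
  rcases hX with hX | ⟨k, s, M, h1, h2, ⟨e⟩⟩
  · exact of_iso (isoZeroBiprod hX) hY
  rcases hY with hY | ⟨k', s', M', h1', h2', ⟨e'⟩⟩
  · exact of_iso (isoBiprodZero hY) (.inr ⟨k, s, M, h1, h2, ⟨e⟩⟩)
  have h3 := h2.symm.trans h2'
  obtain rfl : k = k' := le_antisymm (le_of_add_arctan_le h3.le) (le_of_add_arctan_le h3.ge)
  obtain rfl : s = s' := by
    by_contra hne
    rcases lt_or_gt_of_ne hne with h | h <;> linarith [arctan_div_pi_lt h]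
  have := preservesBinaryBiproducts_of_preservesBiproducts (t.ιHeart (H := R.Rep) ⋙ shiftFunctor D k)
  exact .inr ⟨k, s, M ⊞ M', isSemistable_biprod _ h1 h1', h2,
    ⟨(t.ιHeart ⋙ shiftFunctor D k).mapBiprod M M' ≪≫ biprod.mapIso e e'⟩⟩

variable [IsTriangulated D]

/-- For `M` of slope `s` the charge is `δ(M)(1 + is)`, of argument `arctan s` and modulus `δ(M) /
cos (arctan s)`; a shift by `k` contributes `(-1)^k`. -/
lemma charge (h : slopeSlicing R t θ φ E) (hE : ¬ IsZero E) :
    ∃ m : ℝ, 0 < m ∧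
      chargeOfWeight θ (dimVecD R t E) = m * Complex.exp (Real.pi * φ * Complex.I) := by
  obtain ⟨k, s, M, h1, rfl, ⟨e⟩⟩ := h.resolve_left hE
  have hM : ¬ IsZero M := fun hM => hE <|
    (Functor.map_isZero (t.ιHeart ⋙ shiftFunctor D k) hM).of_iso e.symm
  have hd : (0 : ℝ) < totalDim M := by exact_mod_cast totalDim_pos hM
  have hs := h1.1
  rw [shiftedWeight_dimVec] at hs
  have hcos := Real.cos_arctan_pos s
  refine ⟨totalDim M / Real.cos (Real.arctan s), div_pos hd hcos, ?_⟩
  have h2 : chargeOfWeight θ (dimVec M) = (totalDim M / Real.cos (Real.arctan s) : ℝ) *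
      Complex.exp (Real.arctan s * Complex.I) := by
    apply Complex.ext
    · rw [Complex.re_ofReal_mul, Complex.exp_ofReal_mul_I_re, div_mul_cancel₀ _ hcos.ne']
      simp [chargeOfWeight, totalDim]
    · rw [Complex.im_ofReal_mul, Complex.exp_ofReal_mul_I_im, div_mul_eq_mul_div, mul_div_assoc,
        ← Real.tan_eq_sin_div_cos, Real.tan_arctan]
      simp only [chargeOfWeight, AddMonoidHom.coe_mk, ZeroHom.coe_mk]
      linarith
  have h3 : Complex.exp (Real.pi * ((k + Real.arctan s / Real.pi : ℝ) : ℂ) * Complex.I) =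
      (-1) ^ k * Complex.exp (Real.arctan s * Complex.I) := by
    rw [← Complex.exp_pi_mul_I, ← Complex.exp_int_mul, ← Complex.exp_add]
    congr 1
    have : (Real.pi : ℂ) ≠ 0 := by exact_mod_cast Real.pi_ne_zero
    push_cast
    field_simp
  rw [← t.dimVecD_of_iso R e, t.dimVecD_heart_shift, map_zsmul, h2, h3, zsmul_eq_mul,
    Int.cast_negOnePow]
  ring

/-- For a representation, `‖d‖ ≤ δ = Re Z ≤ |Z|`; the factor `1/2` makes the inequality strict. -/
lemma support (h : slopeSlicing R t θ φ E) (hE : ¬ IsZero E) :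
    1 / 2 * ‖dimVecD R t E‖ < ‖chargeOfWeight θ (dimVecD R t E)‖ := by
  obtain ⟨k, s, M, h1, rfl, ⟨e⟩⟩ := h.resolve_left hE
  have hM : ¬ IsZero M := fun hM => hE <|
    (Functor.map_isZero (t.ιHeart ⋙ shiftFunctor D k) hM).of_iso e.symm
  have hd : (0 : ℝ) < totalDim M := by exact_mod_cast totalDim_pos hM
  suffices 1 / 2 * ‖dimVec M‖ < ‖chargeOfWeight θ (dimVec M)‖ by
    rw [← t.dimVecD_of_iso R e, t.dimVecD_heart_shift]
    rcases Int.units_eq_one_or k.negOnePow with h | h <;> simpa [h] using this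
  have h2 : ‖dimVec M‖ ≤ totalDim M := by
    refine (pi_norm_le_iff_of_nonneg hd.le).2 fun i => ?_
    rw [Int.norm_eq_abs, abs_of_nonneg (by exact_mod_cast dimVec_nonneg M i)]
    exact_mod_cast Finset.single_le_sum (fun j _ => dimVec_nonneg M j) (Finset.mem_univ i)
  have h3 := Complex.abs_re_le_norm (chargeOfWeight θ (dimVec M))
  have h4 : (chargeOfWeight θ (dimVec M)).re = totalDim M := by simp [chargeOfWeight, totalDim]
  rw [h4, abs_of_pos hd] at h3
  linarith

lemma exists_hnList_of_lt (n : ℕ) (M : R.Rep) (hn : totalDim M ≤ n) (c : ℝ)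
    (hc : ∀ (L : R.Rep) (j : L ⟶ M), Mono j → ¬ IsZero L → shiftedWeight θ c (dimVec L) < 0) :
    ∃ l : List ℝ, HNList (slopeSlicing R t θ) l (t.ιHeart.obj M) ∧
      ∀ φ ∈ l, -(1 / 2) < φ ∧ φ < Real.arctan c / Real.pi := by
  induction n generalizing M c with
  | zero =>
    have : IsZero M := (isZero_iff_totalDim M).2 (le_antisymm (by simpa using hn) (totalDim_nonneg M))
    exact ⟨[], .nil (Functor.map_isZero _ this), by simp⟩
  | succ n ih =>
    by_cases hM : IsZero M
    · exact ⟨[], .nil (Functor.map_isZero _ hM), by simp⟩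
    obtain ⟨F, i, s, hi, hF, hs, hmax⟩ := exists_max_slope θ hM
    have hse := shortExact_cokernel i
    have h1 := totalDim_shortExact hse
    have h2 := totalDim_pos hF
    dsimp at h1
    push_cast at hn
    have hsub (L : R.Rep) (j : L ⟶ cokernel i) (hj : Mono j) (hL : ¬ IsZero L) :
        shiftedWeight θ s (dimVec L) < 0 := by
      -- The preimage of `L` in `M`, of class `d(F) + d(L)`. If `L` had slope `s`, so would `G`,
      -- contradicting the maximal dimension of `F`.
      let G := kernel (cokernel.π i ≫ cokernel.π j)
      have h3 := dimVec_kernel (cokernel.π i ≫ cokernel.π j)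
      have h4 := dimVec_cokernel j
      have h5 := dimVec_cokernel i
      have h6 : dimVec G = dimVec F + dimVec L := by
        rw [h5, h4, ← add_assoc] at h3
        exact (add_right_cancel h3).symm
      have h7 : totalDim G = totalDim F + totalDim L := by
        simp [totalDim, h6, Finset.sum_add_distrib]
      have h8 := totalDim_pos hL
      have h9 : ¬ IsZero G := fun h => by
        rw [isZero_iff_totalDim] at h
        lia
      obtain ⟨h10, h11⟩ := hmax G (kernel.ι _) inferInstance h9
      have h12 : shiftedWeight θ s (dimVec G) = shiftedWeight θ s (dimVec L) := by
        rw [h6, map_add, hs, zero_add]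
      rw [h12] at h10 h11
      refine lt_of_le_of_ne h10 fun h => ?_
      have := h11 h
      lia
    obtain ⟨l, hl, hl'⟩ := ih (cokernel i) (by lia) s hsub
    have hss : IsSemistable R (shiftedWeight θ s) F := by
      refine ⟨hs, fun L j hj => ?_⟩
      by_cases hL : IsZero L
      · rw [(isZero_iff_dimVec L).1 hL, map_zero]
      · exact (hmax L (j ≫ i) inferInstance hL).1
    have hsc : s < c := by
      have h3 := hc F i hi hF
      rw [shiftedWeight_dimVec] at h3 hs
      have h4 : (0 : ℝ) < totalDim F := by exact_mod_cast h2
      nlinarith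
    have hF' : HNList (slopeSlicing R t θ) [Real.arctan s / Real.pi] (t.ιHeart.obj F) :=
      .single (of_semistable hss) fun h => hF ((t.isZero_heart_iff F).1 h)
    refine ⟨l ++ [Real.arctan s / Real.pi],
      hF'.append hl (t.hasTriangle_of_shortExact hse) ?_, ?_⟩
    · intro a ha b hb
      rw [List.mem_singleton.1 hb]
      exact (hl' a ha).2
    · intro φ hφ
      rcases List.mem_append.1 hφ with hφ | hφ
      · exact ⟨(hl' φ hφ).1, (hl' φ hφ).2.trans (arctan_div_pi_lt hsc)⟩
      · rw [List.mem_singleton.1 hφ]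
        exact ⟨(arctan_div_pi_mem s).1, arctan_div_pi_lt hsc⟩

variable (t θ) in
lemma exists_hnList_heart (M : R.Rep) : ∃ l : List ℝ,
    HNList (slopeSlicing R t θ) l (t.ιHeart.obj M) ∧ ∀ φ ∈ l, φ ∈ Set.Ioo (-(1 / 2) : ℝ) (1 / 2) := by
  by_cases hM : IsZero M
  · exact ⟨[], .nil (Functor.map_isZero _ hM), by simp⟩
  obtain ⟨F, i, s, hi, hF, hs, hmax⟩ := exists_max_slope θ hM
  -- All subobjects have slope at most `s`, so `s + 1` is a strict bound.
  obtain ⟨l, h, hl⟩ := exists_hnList_of_lt (t := t) _ M (Int.self_le_toNat _) (s + 1)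
    fun L j hj hL => by
      have h1 := (hmax L j hj hL).1
      have h2 : (0 : ℝ) < totalDim L := by exact_mod_cast totalDim_pos hL
      rw [shiftedWeight_dimVec] at h1 ⊢
      linarith
  exact ⟨l, h, fun φ hφ => ⟨(hl φ hφ).1, (hl φ hφ).2.trans (arctan_div_pi_mem _).2⟩⟩

lemma exists_hnList (a b : ℤ) (E : D) (ha : t.IsGE E a) (hb : t.IsLE E b) :
    ∃ l : List ℝ, HNList (slopeSlicing R t θ) l E ∧ ∀ φ ∈ l, -(b : ℝ) - 1 / 2 < φ := by
  obtain ⟨k, hk⟩ : ∃ k : ℕ, b < a + k := ⟨(b - a + 1).toNat, by lia⟩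
  induction k generalizing b E with
  | zero => exact ⟨[], .nil (t.isZero E b a), by simp⟩
  | succ k ih =>
    by_cases hab : a ≤ b
    · have h4 := t.hasTriangle_trunc E b
      have h5 : t.IsLE ((t.truncLT b).obj E) (b - 1) := inferInstance
      have h6 : t.IsGE ((t.truncGE b).obj E) b := inferInstance
      have h7 : t.IsGE ((t.truncLT b).obj E) a := h4.isGE₁ t a ha (t.isGE_of_ge _ _ b)
      have h8 : t.IsLE ((t.truncGE b).obj E) b := h4.isLE₃ t b (t.isLE_of_le _ (b - 1) _) hb
      obtain ⟨M, ⟨e⟩⟩ := t.exists_heart_shift_iso R.Rep ((t.truncGE b).obj E) b h8 h6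
      obtain ⟨l, h, hl⟩ := ih (b - 1) _ h7 h5 (by push_cast at hk; lia)
      obtain ⟨l', h', hl'⟩ := exists_hnList_heart t θ M
      -- The top cohomology has phases in `(-b - 1/2, -b + 1/2)`, the lower truncation phases above
      -- `-b + 1/2`, so the two lists concatenate.
      refine ⟨_, h.append ((h'.shift (k := -b) fun φ X hX => shift (-b) hX).of_iso e) h4 ?_, ?_⟩
      · intro x hx y hy
        obtain ⟨x, hx', rfl⟩ := List.mem_map.1 hx
        have h1 := hl y hy
        have h2 := (hl' x hx').2
        push_cast at h1 ⊢
        linarith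
      · intro x hx
        rcases List.mem_append.1 hx with hx | hx
        · obtain ⟨x, hx', rfl⟩ := List.mem_map.1 hx
          have h2 := (hl' x hx').1
          push_cast
          linarith
        · have h1 := hl x hx
          push_cast at h1
          linarith
    · exact ⟨[], .nil (t.isZero E b a), by simp⟩

end slopeSlicing

variable [IsTriangulated D]

/-- The stability condition with central charge `δ + iθ`, with respect to which the heart consists
of the objects with phases between `-1/2` and `1/2`. -/
def slopeStabilityCondition (ht : ∀ E : D, t.bounded E) : StabilityCondition R t where
  Z := chargeOfWeight θ
  P := slopeSlicing R t θ
  P_iso _ _ _ e h := h.of_iso e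
  P_zero _ _ h := .inl h
  P_biprod _ _ _ h h' := h.biprod h'
  charge _ _ h hE := h.charge hE
  P_shift φ X := by
    refine ⟨fun h => ?_, fun h => by simpa using h.shift 1⟩
    have := (h.shift (-1)).of_iso ((shiftEquiv D (1 : ℤ)).unitIso.symm.app X)
    simpa using this
  hom_eq_zero _ _ _ _ f h hX hY := hX.hom_eq_zero h hY f
  exists_hn E _ := by
    obtain ⟨a, b, ha, hb⟩ := t.exists_bounds ht E
    obtain ⟨l, h, -⟩ := slopeSlicing.exists_hnList (θ := θ) (R := R) a b E ha hb
    obtain ⟨n, φ, h, -⟩ := h.exists_hasHNFiltration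
    exact ⟨n, φ, h⟩
  support := ⟨1 / 2, by norm_num, fun _ _ h hE => h.support hE⟩

lemma slopeStabilityCondition_mem_nearby (ht : ∀ E : D, t.bounded E) :
    slopeStabilityCondition R t θ ht ∈ StabilityCondition.nearby R t := by
  intro M
  obtain ⟨l, h, hl⟩ := slopeSlicing.exists_hnList_heart t θ M
  refine (StabilityCondition.pInterval_iff _).2 ⟨l, h, fun φ hφ => ?_⟩
  have := hl φ hφ
  exact ⟨by linarith [this.1], by linarith [this.2]⟩

lemma imZ_slopeStabilityCondition (ht : ∀ E : D, t.bounded E) :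
    (slopeStabilityCondition R t θ ht).imZ = θ := rfl

end

/-! ### The support of the scattering diagram, and openness of `𝒞(𝒜)`. -/

noncomputable section

open Triangulated QuiverRelations

section Scattering

variable {V : Type u} [Fintype V] [Quiver.{v + 1} V] (R : QuiverRelations V)

lemma dimVec_mem_boundedPositive {k : ℕ} {M : R.Rep} (hM : ¬ IsZero M) (hk : totalDim M ≤ k) :
    dimVec M ∈ boundedPositive V k :=
  ⟨fun h => hM ((isZero_iff_dimVec M).2 h), dimVec_nonneg M, hk⟩

lemma totalDim_le_of_mono {L M : R.Rep} (i : L ⟶ M) [Mono i] : totalDim L ≤ totalDim M :=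
  Finset.sum_le_sum fun j _ => dimVec_le_of_mono i j

theorem scatteringSupport_eq :
    scatteringSupport R = {θ | ∃ M : R.Rep, ¬ IsZero M ∧ IsSemistable R θ M} := by
  ext θ
  simp only [scatteringSupport, Set.mem_iUnion, Set.mem_ofPred_eq]
  constructor
  · rintro ⟨k, -, c, ⟨-, -, -, -, -, -, -, -, -, M, hM, -, h⟩, hθ⟩
    exact ⟨M, hM, h θ hθ⟩
  · rintro ⟨M, hM, h⟩
    have h1 := totalDim_pos hM
    obtain ⟨k, hk⟩ := Int.eq_ofNat_of_zero_le h1.le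
    let B := boundedPositive V k
    have hsub {L : R.Rep} (i : L ⟶ M) (hi : Mono i) (hL : ¬ IsZero L) : dimVec L ∈ B :=
      dimVec_mem_boundedPositive R hL ((totalDim_le_of_mono R i).trans hk.le)
    -- The partition by the sign of `θ`, with `k = δ(M)`. Classes of nonzero subobjects of `M` have
    -- `θ ≤ 0`, so they fall in the last two sets, and the inequalities persist on the whole cone.
    refine ⟨k, by lia, _, ⟨{n ∈ B | 0 < θ n}, {n ∈ B | θ n = 0}, {n ∈ B | θ n < 0}, ?_, ?_, ?_, ?_,
      ⟨dimVec M, hsub (𝟙 M) inferInstance hM, h.1⟩, rfl, M, hM, hk.le, ?_⟩, ?_⟩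
    · ext n
      simp only [Set.mem_union, Set.mem_ofPred_eq, ← and_or_left]
      refine and_iff_left_of_imp fun _ => ?_
      rcases lt_trichotomy (θ n) 0 with h | h | h <;> simp [h]
    · exact Set.disjoint_left.2 fun n h h' => h.2.ne' h'.2
    · exact Set.disjoint_left.2 fun n h h' => h.2.not_gt h'.2
    · exact Set.disjoint_left.2 fun n h h' => h'.2.ne h.2
    · rintro η ⟨-, h0, h2⟩
      refine ⟨h0 _ ⟨hsub (𝟙 M) inferInstance hM, h.1⟩, fun L i hi => ?_⟩
      by_cases hL : IsZero L
      · rw [(isZero_iff_dimVec L).1 hL, map_zero]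
      · rcases (h.2 L i hi).lt_or_eq with h3 | h3
        · exact h2 _ ⟨hsub i hi hL, h3⟩
        · exact (h0 _ ⟨hsub i hi hL, h3⟩).le
    · exact ⟨fun n h => h.2.le, fun n h => h.2, fun n h => h.2.le⟩

end Scattering

lemma List.exists_mem_Icc_of_mem_Ioo {a b : ℝ} (hab : a < b) {l : List ℝ}
    (h : ∀ x ∈ l, x ∈ Set.Ioo a b) : ∃ a' b', a < a' ∧ b' < b ∧ ∀ x ∈ l, x ∈ Set.Icc a' b' := by
  induction l with
  -- With no entries to enclose, the endpoints may be swapped.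
  | nil => exact ⟨b, a, hab, hab, by simp⟩
  | cons y l ih =>
    obtain ⟨a', b', ha, hb, H⟩ := ih fun x hx => h x (List.mem_cons_of_mem _ hx)
    obtain ⟨h1, h2⟩ := h y (by simp)
    refine ⟨min y a', max y b', lt_min h1 ha, max_lt h2 hb, fun x hx => ?_⟩
    rcases List.mem_cons.1 hx with rfl | hx
    · exact ⟨min_le_left _ _, le_max_left _ _⟩
    · exact ⟨(min_le_right _ _).trans (H x hx).1, (H x hx).2.trans (le_max_right _ _)⟩

namespace StabilityCondition

variable {D : Type u'} [Category.{v'} D] [Preadditive D] [HasZeroObject D] [HasShift D ℤ]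
  [∀ n : ℤ, (shiftFunctor D n).Additive] [Pretriangulated D] [IsTriangulated D]

variable {V : Type u} [Fintype V] [Quiver.{v + 1} V] {R : QuiverRelations V}
  {t : TStructure D} [t.Heart R.Rep] (σ : StabilityCondition R t) {E : D}

lemma phases_nonempty (hE : ¬ IsZero E) : (σ.phases E).Nonempty := by
  obtain ⟨l, h⟩ := σ.exists_hnList E
  rcases l with - | ⟨x, l⟩
  · exact (hE h.isZero_of_nil).elim
  · exact ⟨x, σ.mem_phases_iff.2 ⟨_, h, by simp⟩⟩

lemma exists_phases_subset_Icc {a b : ℝ} (hab : a < b) (h : σ.PInterval (Set.Ioo a b) E) :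
    ∃ a' b', a < a' ∧ b' < b ∧ σ.phases E ⊆ Set.Icc a' b' := by
  obtain ⟨l, h, hl⟩ := σ.pInterval_iff.1 h
  obtain ⟨a', b', ha, hb, H⟩ := List.exists_mem_Icc_of_mem_Ioo hab hl
  exact ⟨a', b', ha, hb, σ.phases_subset_of_pInterval (σ.pInterval_iff.2 ⟨l, h, H⟩)⟩

lemma exists_pInterval_Ioo (E : D) : ∃ a b, a < b ∧ σ.PInterval (Set.Ioo a b) E := by
  obtain ⟨l, h⟩ := σ.exists_hnList E
  obtain ⟨a, b, hab⟩ : ∃ a b, ∀ x ∈ l, a < x ∧ x < b := by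
    clear h
    induction l with
    | nil => exact ⟨0, 0, by simp⟩
    | cons y l ih =>
      obtain ⟨a, b, H⟩ := ih
      refine ⟨min a (y - 1), max b (y + 1), fun x hx => ?_⟩
      simp only [min_lt_iff, lt_max_iff]
      rcases List.mem_cons.1 hx with rfl | hx
      · exact ⟨.inr (by linarith), .inr (by linarith)⟩
      · exact ⟨.inl (H x hx).1, .inl (H x hx).2⟩
  exact ⟨min a 0, max b 1, (min_le_right _ _).trans_lt (one_pos.trans_le (le_max_right _ _)),
    σ.pInterval_iff.2 ⟨l, h, fun x hx =>
      ⟨(min_le_left _ _).trans_lt (hab x hx).1, (hab x hx).2.trans_le (le_max_left _ _)⟩⟩⟩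

lemma exists_phases_subset (E : D) : ∃ a b, σ.phases E ⊆ Set.Icc a b := by
  obtain ⟨a, b, hab, h⟩ := σ.exists_pInterval_Ioo E
  obtain ⟨a', b', -, -, H⟩ := σ.exists_phases_subset_Icc hab h
  exact ⟨a', b', H⟩

lemma bddAbove_phases (E : D) : BddAbove (σ.phases E) := by
  obtain ⟨a, b, h⟩ := σ.exists_phases_subset E
  exact ⟨b, fun x hx => (h hx).2⟩

lemma bddBelow_phases (E : D) : BddBelow (σ.phases E) := by
  obtain ⟨a, b, h⟩ := σ.exists_phases_subset E
  exact ⟨a, fun x hx => (h hx).1⟩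

/-- A finite filtration with phases in an open interval has them in a closed subinterval, which by
convexity contains the phases of all filtrations; so the supremum and infimum stay strictly inside.
-/
lemma pInterval_Ioo_iff (hE : ¬ IsZero E) {a b : ℝ} (hab : a < b) :
    σ.PInterval (Set.Ioo a b) E ↔ a < σ.phiMinus E ∧ σ.phiPlus E < b := by
  constructor
  · intro h
    obtain ⟨a', b', ha, hb, H⟩ := σ.exists_phases_subset_Icc hab h
    exact ⟨ha.trans_le (le_csInf (σ.phases_nonempty hE) fun x hx => (H hx).1),
      (csSup_le (σ.phases_nonempty hE) fun x hx => (H hx).2).trans_lt hb⟩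
  · rintro ⟨ha, hb⟩
    obtain ⟨l, h⟩ := σ.exists_hnList E
    refine σ.pInterval_iff.2 ⟨l, h, fun x hx => ?_⟩
    have hx' := σ.mem_phases_iff.2 ⟨l, h, hx⟩
    exact ⟨ha.trans_le (csInf_le (σ.bddBelow_phases E) hx'),
      (le_csSup (σ.bddAbove_phases E) hx').trans_lt hb⟩

variable (R t) in
theorem isOpen_nearby [∀ a b : V, Finite (a ⟶ b)] (hR : R.IsFiniteDimensional) :
    IsOpen (nearby R t) := by
  intro σ hσ
  obtain ⟨s, hs, hs', H⟩ := finite_simples hR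
  have hI (τ : StabilityCondition R t) (X : R.Rep) (hX : X ∈ s) :
      τ.PInterval (Set.Ioo (-1) 1) (t.ιHeart.obj X) ↔
        -1 < τ.phiMinus (t.ιHeart.obj X) ∧ τ.phiPlus (t.ιHeart.obj X) < 1 := by
    have := hs' X hX
    exact τ.pInterval_Ioo_iff (fun h => Simple.not_isZero X ((t.isZero_heart_iff X).1 h))
      (by norm_num)
  -- A common margin between the extreme phases of the finitely many simple objects and the
  -- endpoints `-1` and `1`.
  obtain ⟨ε, hε, hε'⟩ : ∃ ε : ℝ, 0 < ε ∧ ∀ X ∈ s, ε ≤ σ.phiMinus (t.ιHeart.obj X) + 1 ∧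
      ε ≤ 1 - σ.phiPlus (t.ιHeart.obj X) := by
    clear H
    induction s, hs using Set.Finite.induction_on with
    | empty => exact ⟨1, one_pos, by simp⟩
    | @insert X s _ _ ih =>
      obtain ⟨ε, h1, h2⟩ := ih (fun X hX => hs' X (Set.mem_insert_of_mem _ hX))
        (fun τ X hX => hI τ X (Set.mem_insert_of_mem _ hX))
      obtain ⟨h3, h4⟩ := (hI σ X (Set.mem_insert _ _)).1 (hσ X)
      refine ⟨min ε (min (σ.phiMinus (t.ιHeart.obj X) + 1) (1 - σ.phiPlus (t.ιHeart.obj X))),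
        lt_min h1 (lt_min (by linarith) (by linarith)), ?_⟩
      rintro Y (rfl | hY)
      · exact ⟨(min_le_right _ _).trans (min_le_left _ _),
          (min_le_right _ _).trans (min_le_right _ _)⟩
      · exact ⟨(min_le_left _ _).trans (h2 Y hY).1, (min_le_left _ _).trans (h2 Y hY).2⟩
  refine ⟨ε, hε, fun τ hτ => induction_simple _ (fun M hM => ?_) (fun S hS => ?_)
    fun S hS h1 h3 => τ.pInterval_of_hasTriangle h1 h3 (t.hasTriangle_of_shortExact hS)⟩
  · exact τ.pInterval_of_isZero ((t.isZero_heart_iff M).2 hM)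
  · obtain ⟨X, hX, ⟨e⟩⟩ := H S hS
    have := hs' X hX
    obtain ⟨h1, h2⟩ := hτ.1 (t.ιHeart.obj X)
      fun h => Simple.not_isZero X ((t.isZero_heart_iff X).1 h)
    rw [abs_lt] at h1 h2
    obtain ⟨h3, h4⟩ := hε' X hX
    exact τ.pInterval_of_iso ((hI τ X hX).2 ⟨by linarith [h2.1], by linarith [h1.2]⟩)
      (t.ιHeart.mapIso e)

end StabilityCondition

end

theorem theorem1p2 {V : Type u} [Fintype V] [Quiver.{v + 1} V] [∀ a b : V, Finite (a ⟶ b)]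
    (R : QuiverRelations V) (hR : R.IsFiniteDimensional)
    {D : Type u'} [Category.{v'} D] [Preadditive D] [HasZeroObject D] [HasShift D ℤ]
    [∀ n : ℤ, (shiftFunctor D n).Additive] [Pretriangulated D] [IsTriangulated D]
    (t : Triangulated.TStructure D) (ht : ∀ E : D, t.bounded E) [t.Heart R.Rep] :
    IsOpen (StabilityCondition.nearby R t) ∧
    -- surjectivity of `Im Z : 𝒞(𝒜) → M_ℝ`
    (∀ θ : (V → ℤ) →+ ℝ, ∃ σ ∈ StabilityCondition.nearby R t, σ.imZ = θ) ∧
    (∀ θ : (V → ℤ) →+ ℝ, IsTorsionPair (torsionPart R θ) (torsionFreePart R θ)) ∧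
    -- the heart and the subcategory `P(0)` of a nearby stability condition in the fibre over `θ`
    (∀ σ ∈ StabilityCondition.nearby R t, ∀ θ : (V → ℤ) →+ ℝ, σ.imZ = θ →
      σ.heart = tiltedHeart R t θ ∧
      ∀ E : D, σ.P 0 E ↔ ∃ M : R.Rep, IsSemistable R θ M ∧ Nonempty (t.ιHeart.obj M ≅ E)) ∧
    -- the image of the union of the walls of type II
    StabilityCondition.imZ '' (StabilityCondition.nearby R t ∩
        ⋃ (E : D) (_ : ¬ IsZero E), StabilityCondition.typeIIWall R t E) =
      scatteringSupport R ∧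
    scatteringSupport R = {θ | ∃ M : R.Rep, ¬ IsZero M ∧ IsSemistable R θ M} := by
  have hmem (θ) := slopeStabilityCondition_mem_nearby R t θ ht
  refine ⟨StabilityCondition.isOpen_nearby R t hR,
    fun θ => ⟨_, hmem θ, imZ_slopeStabilityCondition R t θ ht⟩,
    fun θ => StabilityCondition.isTorsionPair_imZ ht (hmem θ), ?_, ?_, scatteringSupport_eq R⟩
  · rintro σ hσ _ rfl
    exact ⟨StabilityCondition.heart_eq_tiltedHeart ht hσ, StabilityCondition.P_zero_iff ht hσ⟩
  · rw [scatteringSupport_eq]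
    ext θ
    simp only [Set.mem_image, Set.mem_inter_iff, Set.mem_iUnion, Set.mem_ofPred_eq]
    constructor
    · rintro ⟨σ, ⟨hσ, E, hE, hP⟩, rfl⟩
      obtain ⟨M, hM, ⟨e⟩⟩ := (StabilityCondition.P_zero_iff ht hσ E).1 hP
      exact ⟨M, fun h => hE (((t.isZero_heart_iff M).2 h).of_iso e.symm), hM⟩
    · rintro ⟨M, hM, h⟩
      -- Any point of the fibre over `θ` lies on the wall of `M`; the slope stability condition is
      -- one.
      refine ⟨_, ⟨hmem θ, t.ιHeart.obj M, fun h => hM ((t.isZero_heart_iff M).1 h), ?_⟩,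
        imZ_slopeStabilityCondition R t θ ht⟩
      exact (StabilityCondition.P_zero_iff ht (hmem θ) _).2 ⟨M, h, ⟨Iso.refl _⟩⟩
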